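/- **Conventions.** For a simplicial set $K$ let $\pi K$ be its fundamental groupoid and $N$ the nerve, so that $\pi\dashv N$. Let $\mathcal C$ be a simplicial model category (a model category that is enriched, tensored and cotensored over simplicial sets and satisfies Quillen's axiom SM7) which has small products. Its simplicial structure *derives from an enrichment over groupoids* if $\mathcal C$ is also enriched, tensored and cotensored over the category $\mathrm{Grpd}$ of groupoids and there are natural isomorphisms $\mathrm{sSet}(A,B)\cong N(\mathrm{Grpd}(A,B))$, $A^K\cong A^{\pi K}$, $A\otimes K\cong A\otimes \pi K$ for $A,B\in\mathcal C$ and simplicial sets $K$, compatible with identities, composition and the universal maps of the (co)tensors. For a small category $I$ and an $I$-diagram $X$ with all $X(i)$ fibrant, $\operatorname{holim}_I X$ denotes the equalizer of the two natural maps $$\prod_{i\in I} X(i)^{N(I/i)}\rightrightarrows\prod_{j\to i}X(i)^{N(I/j)} .$$ **Theorem.** (1) Let $\mathcal C$ be a simplicial model category whose simplicial structure derives from an enrichment over groupoids. For a cosimplicial object $X^\bullet$ of $\mathcal C$ let $E(X^\bullet)$ be the equalizer of the natural maps $$\prod_{i=0}^{2}(X^i)^{\Delta^i}\rightrightarrows\prod_{[j]\to[i],\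 i\le 2,\ j\le 1}(X^i)^{\Delta^j}.$$ There is a map $E(X^\bullet)\to\operatorname{holim}_\Delta X^\bullet$, natural in $X^\bullet$, which is a simplicial homotopy equivalence and a weak equivalence whenever every $X^i$ is fibrant. Moreover $E(X^\bullet)$ is naturally isomorphic, over $\prod_{i\le 2}(X^i)^{\Delta^i}$, to $\mathrm{Tot}_2X^\bullet$, the equalizer of $\prod_{i\le 2}(X^i)^{\Delta^i}\rightrightarrows\prod_{[j]\to[i],\ i,j\le 2}(X^i)^{\Delta^j}$. (2) For a cosimplicial groupoid $X^\bullet$ (with $G^K=\mathrm{Fun}(\pi K,G)$ for a groupoid $G$), let $\mathrm{Desc}(X^\bullet)$ be the groupoid whose objects are the pairs $(a,\alpha)$ of an object $a$ of $X^0$ and a morphism $\alpha\colon d^1(a)\to d^0(a)$ of $X^1$ such that $s^0(\alpha)=\mathrm{id}_a$ and $d^0(\alpha)\circ d^2(\alpha)=d^1(\alpha)$, and whose morphisms $(a,\alpha)\to(a',\alpha')$ are the morphisms $\beta\colon a\to a'$ of $X^0$ such that $\alpha'\circ d^1(\beta)=d^0(\beta)\circ\alpha$. Then $\mathrm{Desc}(X^\bullet)$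 is isomorphic, naturally in $X^\bullet$, to the equalizer $E(X^\bullet)$ and to $\mathrm{Tot}_2X^\bullet$, and there is a functor $\mathrm{Desc}(X^\bullet)\to\operatorname{holim}_\Delta X^\bullet$, natural in $X^\bullet$, which is an equivalence of categories. -/

import Mathlib

open CategoryTheory Limits MonoidalCategory CartesianMonoidalCategory Opposite Simplicial
  HomotopicalAlgebra

universe v u v' u'

namespace HolimGrpd

noncomputable section

/-! ### Tensors and cotensors in an enriched category -/

section Cotensor

variable (V : Type u') [Category.{v'} V] [MonoidalCategory V]
  {C : Type u} [Category.{v} C] [EnrichedOrdinaryCategory V C]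

/-- A cotensor `A^K` of `A : C` by `K : V`: an object with a universal morphism
`K ⟶ Hom(A^K, A)`.  The last field says that the induced map `Hom(B, A^K) ⟶ [K, Hom(B, A)]`
is an isomorphism, tested on all generalized elements `L ⟶ Hom(B, A^K)`. -/
structure Cotensor (K : V) (A : C) where
  obj : C
  ev : K ⟶ (obj ⟶[V] A)
  bijective (B : C) (L : V) : Function.Bijective
    (fun f : L ⟶ (B ⟶[V] obj) => ((f ⊗ₘ ev) ≫ eComp V B obj A : L ⊗ K ⟶ (B ⟶[V] A)))

/-- A tensor `A ⊗ K` of `A : C` by `K : V`: an object with a universal morphism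
`K ⟶ Hom(A, A ⊗ K)`, i.e. such that `Hom(A ⊗ K, B) ≅ [K, Hom(A, B)]`. -/
structure Tensor (K : V) (A : C) where
  obj : C
  coev : K ⟶ (A ⟶[V] obj)
  bijective (B : C) (L : V) : Function.Bijective
    (fun f : L ⟶ (obj ⟶[V] B) => ((coev ⊗ₘ f) ≫ eComp V A obj B : K ⊗ L ⟶ (A ⟶[V] B)))

variable (C) in
/-- A `V`-enriched category with tensors and cotensors. -/
class TensoredCotensored where
  tensor (K : V) (A : C) : Tensor V K A
  cotensor (K : V) (A : C) : Cotensor V K A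

variable [TensoredCotensored V C]

/-- The cotensor `A^K`. -/
def pow (K : V) (A : C) : C := (TensoredCotensored.cotensor K A : Cotensor V K A).obj

/-- The universal morphism `K ⟶ Hom(A^K, A)`. -/
def powEv (K : V) (A : C) : K ⟶ (pow V K A ⟶[V] A) :=
  (TensoredCotensored.cotensor K A : Cotensor V K A).ev

/-- The tensor `A ⊗ K`. -/
def ten (K : V) (A : C) : C := (TensoredCotensored.tensor K A : Tensor V K A).obj

/-- The universal morphism `K ⟶ Hom(A, A ⊗ K)`. -/
def tenCoev (K : V) (A : C) : K ⟶ (A ⟶[V] ten V K A) :=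
  (TensoredCotensored.tensor K A : Tensor V K A).coev

variable {V}

lemma pow_bijective (K : V) (A B : C) (L : V) : Function.Bijective
    (fun f : L ⟶ (B ⟶[V] pow V K A) =>
      ((f ⊗ₘ powEv V K A) ≫ eComp V B (pow V K A) A : L ⊗ K ⟶ (B ⟶[V] A))) :=
  (TensoredCotensored.cotensor K A : Cotensor V K A).bijective B L

/-- The morphism `B ⟶ A^K` that corresponds to `φ : K ⟶ Hom(B, A)`. -/
def powLift {K : V} {A B : C} (φ : K ⟶ (B ⟶[V] A)) : B ⟶ pow V K A :=
  (eHomEquiv V).symm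
    ((Equiv.ofBijective _ (pow_bijective K A B (𝟙_ V))).symm ((λ_ K).hom ≫ φ))

lemma powEv_whisker {K : V} {A B : C} (f : B ⟶ pow V K A) :
    powEv V K A ≫ eHomWhiskerRight V f A =
      (λ_ K).inv ≫ (eHomEquiv V f ⊗ₘ powEv V K A) ≫ eComp V B (pow V K A) A := by
  rw [eHomWhiskerRight, leftUnitor_inv_naturality_assoc, tensorHom_def', Category.assoc]

lemma powEv_powLift {K : V} {A B : C} (φ : K ⟶ (B ⟶[V] A)) :
    powEv V K A ≫ eHomWhiskerRight V (powLift φ) A = φ := by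
  rw [powEv_whisker, powLift, Equiv.apply_symm_apply]
  have := (Equiv.ofBijective _ (pow_bijective K A B (𝟙_ V))).apply_symm_apply ((λ_ K).hom ≫ φ)
  rw [Equiv.ofBijective_apply] at this
  rw [this, Iso.inv_hom_id_assoc]

lemma pow_hom_ext {K : V} {A B : C} {f g : B ⟶ pow V K A}
    (h : powEv V K A ≫ eHomWhiskerRight V f A = powEv V K A ≫ eHomWhiskerRight V g A) :
    f = g := by
  rw [powEv_whisker, powEv_whisker] at h
  apply (eHomEquiv V).injective
  apply (pow_bijective K A B (𝟙_ V)).1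
  exact (cancel_epi _).1 h

/-- `A^K ⟶ A'^K'` induced by `K' ⟶ K` and `A ⟶ A'`. -/
def powMap {K K' : V} {A A' : C} (κ : K' ⟶ K) (a : A ⟶ A') : pow V K A ⟶ pow V K' A' :=
  powLift (κ ≫ powEv V K A ≫ eHomWhiskerLeft V _ a)

lemma powEv_powMap {K K' : V} {A A' : C} (κ : K' ⟶ K) (a : A ⟶ A') :
    powEv V K' A' ≫ eHomWhiskerRight V (powMap κ a) A' =
      κ ≫ powEv V K A ≫ eHomWhiskerLeft V _ a := powEv_powLift _

lemma powMap_id (K : V) (A : C) : powMap (𝟙 K) (𝟙 A) = 𝟙 (pow V K A) := by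
  apply pow_hom_ext
  rw [powEv_powMap]
  simp

lemma powMap_comp {K K' K'' : V} {A A' A'' : C} (κ : K' ⟶ K) (κ' : K'' ⟶ K')
    (a : A ⟶ A') (a' : A' ⟶ A'') :
    powMap κ a ≫ powMap κ' a' = powMap (κ' ≫ κ) (a ≫ a') := by
  apply pow_hom_ext
  rw [powEv_powMap, eHomWhiskerRight_comp, ← Category.assoc, powEv_powMap]
  simp only [Category.assoc, eHom_whisker_exchange, eHomWhiskerLeft_comp]
  rw [← Category.assoc (powEv V K' A'), powEv_powMap]
  simp

variable (V C) in
/-- The cotensor bifunctor `(K, A) ↦ A^K`. -/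
def powFunctor : Vᵒᵖ ⥤ C ⥤ C where
  obj K :=
    { obj A := pow V K.unop A
      map a := powMap (𝟙 K.unop) a
      map_id A := powMap_id _ _
      map_comp a a' := by rw [powMap_comp, Category.comp_id] }
  map κ :=
    { app A := powMap κ.unop (𝟙 A)
      naturality A A' a := by simp [powMap_comp] }
  map_id K := by ext A; exact powMap_id _ _
  map_comp κ κ' := by ext A; simp [powMap_comp]

end Cotensor

/-! ### Simplicial model categories -/

section SimplicialModel

variable (C : Type u) [Category.{v} C] [SimplicialCategory C]

open SimplicialCategory

variable {C} in
/-- The map `Hom(B, X) ⟶ Hom(A, X) ×_{Hom(A, Y)} Hom(B, Y)` of simplicial sets. -/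
def pullbackHom {A B X Y : C} (i : A ⟶ B) (p : X ⟶ Y) :
    sHom B X ⟶ pullback (eHomWhiskerLeft SSet.{v} A p) (eHomWhiskerRight SSet.{v} i Y) :=
  pullback.lift (eHomWhiskerRight SSet.{v} i X) (eHomWhiskerLeft SSet.{v} B p)
    (eHom_whisker_exchange SSet.{v} i p).symm

/-- A simplicial model category: a model category which is enriched, tensored and cotensored over
simplicial sets and such that, for a cofibration `i` and a fibration `p`, the map `pullbackHom i p`
is a Kan fibration, and a trivial Kan fibration if moreover `i` or `p` is a weak equivalence. -/
class IsSimplicialModelCategory [ModelCategory C] [TensoredCotensored SSet.{v} C] : Prop where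
  fibration {A B X Y : C} (i : A ⟶ B) (p : X ⟶ Y) [Cofibration i] [Fibration p] :
    SSet.modelCategoryQuillen.J.rlp (pullbackHom i p)
  trivial_left {A B X Y : C} (i : A ⟶ B) (p : X ⟶ Y) [Cofibration i] [Fibration p]
    [WeakEquivalence i] : SSet.modelCategoryQuillen.I.rlp (pullbackHom i p)
  trivial_right {A B X Y : C} (i : A ⟶ B) (p : X ⟶ Y) [Cofibration i] [Fibration p]
    [WeakEquivalence p] : SSet.modelCategoryQuillen.I.rlp (pullbackHom i p)

variable {C}

/-- A simplicial homotopy from `f` to `g`: an edge from `f` to `g` in `Hom(A, B)`. -/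
def SimplicialHomotopic {A B : C} (f g : A ⟶ B) : Prop :=
  ∃ h : sHom A B _⦋1⦌,
    (sHom A B).δ 1 h = homEquiv' A B f ∧ (sHom A B).δ 0 h = homEquiv' A B g

/-- Simplicial homotopy equivalences. -/
def IsSimplicialHomotopyEquiv {A B : C} (f : A ⟶ B) : Prop :=
  ∃ g : B ⟶ A, SimplicialHomotopic (f ≫ g) (𝟙 A) ∧ SimplicialHomotopic (g ≫ f) (𝟙 B)

end SimplicialModel

/-! ### Groupoids -/

section Groupoids

/-- The one-object groupoid with one morphism is terminal. -/
def grpdUnitIsTerminal : IsTerminal (Grpd.of (Discrete PUnit.{v + 1}) : Grpd.{v, v}) :=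
  IsTerminal.ofUniqueHom (fun G => (Functor.const G).obj ⟨PUnit.unit⟩) (fun _ _ => rfl)

/-- The product groupoid. -/
def grpdProdCone (G H : Grpd.{v, v}) : BinaryFan G H :=
  .mk (P := Grpd.of (G × H)) (CategoryTheory.Prod.fst G H) (CategoryTheory.Prod.snd G H)

/-- The product groupoid is a product in the category of groupoids. -/
def grpdProdConeIsLimit (G H : Grpd.{v, v}) : IsLimit (grpdProdCone G H) :=
  BinaryFan.isLimitMk (W := Grpd.of (G × H)) (fst := CategoryTheory.Prod.fst G H)
    (snd := CategoryTheory.Prod.snd G H)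
    (fun s => (Functor.prod' (s.fst : s.pt ⥤ G) (s.snd : s.pt ⥤ H) : s.pt ⥤ G × H))
    (fun _ => rfl) (fun _ => rfl)
    (fun s m h₁ h₂ => by
      rw [← h₁, ← h₂]
      rfl)

instance : CartesianMonoidalCategory Grpd.{v, v} :=
  .ofChosenFiniteProducts ⟨_, grpdUnitIsTerminal⟩
    (fun G H => ⟨grpdProdCone G H, grpdProdConeIsLimit G H⟩)

/-- The nerve of a groupoid. -/
abbrev grpdNerve : Grpd.{v, v} ⥤ SSet.{v} := Grpd.forgetToCat ⋙ nerveFunctor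

/-- The fundamental groupoid of a simplicial set: the groupoid obtained by inverting all morphisms
of the homotopy category, whose objects are the vertices and whose morphisms are generated by the
edges, with a relation for each degenerate edge and each triangle. -/
abbrev fundGrpd : SSet.{v} ⥤ Grpd.{v, v} := SSet.hoFunctor ⋙ Grpd.free

/-- The fundamental groupoid is left adjoint to the nerve. -/
def fundGrpdAdj : fundGrpd.{v} ⊣ grpdNerve.{v} :=
  nerveAdjunction.comp Grpd.freeForgetAdjunction

/-- Functors into a groupoid form a groupoid. -/
instance functorGroupoid (K G : Type v) [Groupoid.{v} K] [Groupoid.{v} G] :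
    Groupoid.{v} (K ⥤ G) where
  inv α :=
    { app k := Groupoid.inv (α.app k)
      naturality k l f := by simp [← cancel_epi (α.app k)] }

/-- The bifunctor `(K, G) ↦ Fun(K, G)` on groupoids. -/
def grpdFun : Grpd.{v, v}ᵒᵖ ⥤ Grpd.{v, v} ⥤ Grpd.{v, v} where
  obj K :=
    { obj G := Grpd.of ((K.unop : Type v) ⥤ G)
      map F := (Functor.whiskeringRight _ _ _).obj F }
  map κ := { app G := (Functor.whiskeringLeft _ _ G).obj κ.unop }

/-- The cotensor `G^K = Fun(π K, G)` of a groupoid `G` by a simplicial set `K`. -/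
def grpdPow : SSet.{v}ᵒᵖ ⥤ Grpd.{v, v} ⥤ Grpd.{v, v} := fundGrpd.op ⋙ grpdFun

instance : HasLimits Grpd.{v, v} := hasLimits_of_reflective Grpd.forgetToCat

instance : HasProducts.{0} Grpd.{v, v} := fun _ => inferInstance

end Groupoids

/-! ### Simplicial structures that derive from an enrichment over groupoids -/

section Derives

open SimplicialCategory

/-- The simplicial structure on `C` derives from the given enrichment over groupoids. -/
structure DerivesFromGrpd (C : Type u) [Category.{v} C]
    [SimplicialCategory C] [TensoredCotensored SSet.{v} C]
    [EnrichedOrdinaryCategory Grpd.{v, v} C] [TensoredCotensored Grpd.{v, v} C] where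
  /-- The simplicial hom is the nerve of the groupoid hom, -/
  homIso (A B : C) : sHom A B ≅ grpdNerve.obj (A ⟶[Grpd.{v, v}] B)
  /-- compatibly with the underlying morphisms of `C` (identities included) -/
  homEquiv_comp {A B : C} (f : A ⟶ B) :
    grpdNerve.map (eHomEquiv Grpd.{v, v} f) ≫ (homIso A B).inv =
      toUnit _ ≫ eHomEquiv SSet.{v} f
  /-- and with composition. -/
  eComp_comp (A B D : C) :
    grpdNerve.map (eComp Grpd.{v, v} A B D) ≫ (homIso A D).inv =
      prodComparison grpdNerve _ _ ≫ ((homIso A B).inv ⊗ₘ (homIso B D).inv) ≫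
        eComp SSet.{v} A B D
  /-- The cotensor `A^K` is the cotensor `A^(π K)`, -/
  powIso (K : SSet.{v}) (A : C) : pow SSet.{v} K A ≅ pow Grpd.{v, v} (fundGrpd.obj K) A
  /-- compatibly with the universal morphisms (hence naturally in `K` and `A`, and compatibly with
  iterated cotensors and `π (K × K') ≅ π K × π K'`). -/
  powEv_comp (K : SSet.{v}) (A : C) :
    powEv SSet.{v} K A ≫ (homIso _ A).hom =
      fundGrpdAdj.unit.app K ≫ grpdNerve.map (powEv Grpd.{v, v} (fundGrpd.obj K) A ≫
        eHomWhiskerRight Grpd.{v, v} (powIso K A).hom A)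
  /-- The tensor `A ⊗ K` is the tensor `A ⊗ π K`, -/
  tenIso (K : SSet.{v}) (A : C) : ten SSet.{v} K A ≅ ten Grpd.{v, v} (fundGrpd.obj K) A
  /-- compatibly with the universal morphisms. -/
  tenCoev_comp (K : SSet.{v}) (A : C) :
    tenCoev SSet.{v} K A ≫ (homIso A _).hom =
      fundGrpdAdj.unit.app K ≫ grpdNerve.map (tenCoev Grpd.{v, v} (fundGrpd.obj K) A ≫
        eHomWhiskerLeft Grpd.{v, v} A (tenIso K A).inv)

end Derives

/-! ### The equalizers -/

section Equalizers

variable {C : Type u} [Category.{v} C] {I : Type} [SmallCategory I]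

/-- The arrows `α : j ⟶ i` of `I` where `i` and `j` satisfy `p` and `j` satisfies `q`. -/
structure Arr (p q : I → Prop) where
  src : I
  tgt : I
  hom : src ⟶ tgt
  src_mem : p src
  src_mem' : q src
  tgt_mem : p tgt

variable [HasProducts.{0} C] (P : SSet.{v}ᵒᵖ ⥤ C ⥤ C) (W : I ⥤ SSet.{v}) (p q : I → Prop)

/-- `∏_i X(i)^{W(i)}`, the product over the `i` that satisfy `p`;
here `A^K` is `(P.obj (op K)).obj A`. -/
abbrev prodObj (X : I ⥤ C) : C :=
  ∏ᶜ fun i : {i : I // p i} => (P.obj (op (W.obj i.1))).obj (X.obj i.1)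

/-- `∏_{j ⟶ i} X(i)^{W(j)}`, the product over `Arr p q`. -/
abbrev prodArr (X : I ⥤ C) : C :=
  ∏ᶜ fun a : Arr p q => (P.obj (op (W.obj a.src))).obj (X.obj a.tgt)

/-- The map with component `X(i)^{W(i)} ⟶ X(i)^{W(j)}` at `j ⟶ i`. -/
def leftMap (X : I ⥤ C) : prodObj P W p X ⟶ prodArr P W p q X :=
  Pi.lift fun a => Pi.π _ (⟨a.tgt, a.tgt_mem⟩ : {i : I // p i}) ≫
    (P.map (W.map a.hom).op).app (X.obj a.tgt)

/-- The map with component `X(j)^{W(j)} ⟶ X(i)^{W(j)}` at `j ⟶ i`. -/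
def rightMap (X : I ⥤ C) : prodObj P W p X ⟶ prodArr P W p q X :=
  Pi.lift fun a => Pi.π _ (⟨a.src, a.src_mem⟩ : {i : I // p i}) ≫
    (P.obj (op (W.obj a.src))).map (X.map a.hom)

/-- The map `∏_i X(i)^{W(i)} ⟶ ∏_i Y(i)^{W(i)}` induced by `X ⟶ Y`. -/
def prodObjMap {X Y : I ⥤ C} (f : X ⟶ Y) : prodObj P W p X ⟶ prodObj P W p Y :=
  Limits.Pi.map fun i => (P.obj (op (W.obj i.1))).map (f.app i.1)

/-- The map `∏_{j ⟶ i} X(i)^{W(j)} ⟶ ∏_{j ⟶ i} Y(i)^{W(j)}` induced by `X ⟶ Y`. -/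
def prodArrMap {X Y : I ⥤ C} (f : X ⟶ Y) : prodArr P W p q X ⟶ prodArr P W p q Y :=
  Limits.Pi.map fun a => (P.obj (op (W.obj a.src))).map (f.app a.tgt)

lemma leftMap_natural {X Y : I ⥤ C} (f : X ⟶ Y) :
    prodObjMap P W p f ≫ leftMap P W p q Y = leftMap P W p q X ≫ prodArrMap P W p q f := by
  refine Pi.hom_ext _ _ fun a => ?_
  simp [prodObjMap, prodArrMap, leftMap]

lemma rightMap_natural {X Y : I ⥤ C} (f : X ⟶ Y) :
    prodObjMap P W p f ≫ rightMap P W p q Y = rightMap P W p q X ≫ prodArrMap P W p q f := by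
  refine Pi.hom_ext _ _ fun a => ?_
  simp [prodObjMap, prodArrMap, rightMap, ← Functor.map_comp]

variable [HasEqualizers C]

/-- The equalizer of `∏_i X(i)^{W(i)} ⇉ ∏_{j ⟶ i} X(i)^{W(j)}`, as a functor of `X`. -/
def eqz : (I ⥤ C) ⥤ C where
  obj X := equalizer (leftMap P W p q X) (rightMap P W p q X)
  map {X Y} f := equalizer.lift (equalizer.ι _ _ ≫ prodObjMap P W p f) (by
    rw [Category.assoc, Category.assoc, leftMap_natural, rightMap_natural,
      equalizer.condition_assoc])
  map_id X := by
    apply equalizer.hom_ext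
    refine Pi.hom_ext _ _ fun i => ?_
    simp [prodObjMap]
  map_comp f g := by
    apply equalizer.hom_ext
    refine Pi.hom_ext _ _ fun i => ?_
    simp [prodObjMap]

/-- The inclusion of the equalizer into `∏_i X(i)^{W(i)}`. -/
def eqzι (X : I ⥤ C) : (eqz P W p q).obj X ⟶ prodObj P W p X :=
  equalizer.ι (leftMap P W p q X) (rightMap P W p q X)

variable (I) in
/-- The functor `i ↦ N(I/i)`. -/
def overNerve : I ⥤ SSet.{v} := Over.mapFunctor I ⋙ nerveFunctor ⋙ SSet.uliftFunctor.{v, 0}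

/-- The homotopy limit of an objectwise fibrant diagram `X`, i.e. the equalizer of
`∏_i X(i)^{N(I/i)} ⇉ ∏_{j ⟶ i} X(i)^{N(I/j)}`. -/
def holim : (I ⥤ C) ⥤ C := eqz P (overNerve I) (fun _ => True) (fun _ => True)

/-- The weight `[n] ↦ Δ^n`. -/
abbrev simplices : SimplexCategory ⥤ SSet.{v} := SSet.stdSimplex.{v}

/-- The equalizer of `∏_{i ≤ n} (X^i)^{Δ^i} ⇉ ∏_{[j] ⟶ [i], i ≤ n, j ≤ min m n} (X^i)^{Δ^j}`. -/
def truncTot (n m : ℕ) : (SimplexCategory ⥤ C) ⥤ C :=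
  eqz P simplices (fun i => i.len ≤ n) (fun j => j.len ≤ m)

/-- The inclusion of `truncTot P n m` into `∏_{i ≤ n} (X^i)^{Δ^i}`. -/
def truncTotι (n m : ℕ) (X : SimplexCategory ⥤ C) :
    (truncTot P n m).obj X ⟶ prodObj P simplices (fun i => i.len ≤ n) X :=
  eqzι P simplices (fun i => i.len ≤ n) (fun j => j.len ≤ m) X

end Equalizers

/-! ### The descent groupoid -/

section Descent

open SimplexCategory

/-- A cosimplicial identity on objects. -/
lemma obj_eq (X : SimplexCategory ⥤ Grpd.{v, v}) {i j j' k : SimplexCategory}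
    {f : i ⟶ j} {g : j ⟶ k} {f' : i ⟶ j'} {g' : j' ⟶ k} (h : f ≫ g = f' ≫ g')
    (a : X.obj i) :
    (X.map g).obj ((X.map f).obj a) = (X.map g').obj ((X.map f').obj a) := by
  have := congrArg (fun t => (X.map t : X.obj i ⥤ X.obj k).obj a) h
  simpa only [X.map_comp] using! this

/-- A cosimplicial identity on objects. -/
lemma obj_eq_id (X : SimplexCategory ⥤ Grpd.{v, v}) {i j : SimplexCategory}
    {f : i ⟶ j} {g : j ⟶ i} (h : f ≫ g = 𝟙 i) (a : X.obj i) :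
    (X.map g).obj ((X.map f).obj a) = a := by
  have := congrArg (fun t => (X.map t : X.obj i ⥤ X.obj i).obj a) h
  simpa only [X.map_comp, X.map_id] using! this

lemma map_eqToHom_aux {A B : Type v} [Category.{v} A] [Category.{v} B] (H : A ⥤ B) {x y x' y' : A}
    (f : x ⟶ y) {r r₁ s s₁ : B} (h₁ : r = H.obj x) (h₂ : H.obj y = s) (h₃ : r = r₁)
    (h₄ : r₁ = H.obj x') (h₅ : x' = x) (h₆ : y = y') (h₇ : H.obj y' = s₁) (h₈ : s₁ = s) :
    eqToHom h₁ ≫ H.map f ≫ eqToHom h₂ = eqToHom h₃ ≫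
      (eqToHom h₄ ≫ H.map (eqToHom h₅ ≫ f ≫ eqToHom h₆) ≫ eqToHom h₇) ≫ eqToHom h₈ := by
  subst h₅ h₆ h₄ h₂ h₈
  simp

/-- An object `(a, α : d¹ a ⟶ d⁰ a)` of the descent groupoid of a cosimplicial groupoid `X`, with
`s⁰ α = id` and `d⁰ α ∘ d² α = d¹ α`.  The morphisms `eqToHom` are the identities that express the
cosimplicial identities between objects such as `s⁰ d¹ a = a`. -/
structure Desc (X : SimplexCategory ⥤ Grpd.{v, v}) where
  a : X.obj ⦋0⦌
  α : (X.map (δ 1)).obj a ⟶ (X.map (δ 0)).obj a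
  unit : (X.map (σ 0)).map α = eqToHom ((obj_eq_id X (δ_comp_σ_succ (i := 0)) a).trans
    (obj_eq_id X (δ_comp_σ_self (i := 0)) a).symm)
  cocycle : (X.map (δ 2)).map α ≫
      eqToHom (obj_eq X (δ_comp_δ (i := 0) (j := 1) (by decide)) a) ≫ (X.map (δ 0)).map α =
    eqToHom (obj_eq X (δ_comp_δ_self (i := 1)).symm a) ≫ (X.map (δ 1)).map α ≫
      eqToHom (obj_eq X (δ_comp_δ_self (i := 0)).symm a)

namespace Desc

variable {X Y : SimplexCategory ⥤ Grpd.{v, v}}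

/-- A morphism `(a, α) ⟶ (a', α')`: a morphism `β : a ⟶ a'` with `α' ∘ d¹ β = d⁰ β ∘ α`. -/
@[ext]
structure Hom (x y : Desc X) where
  β : x.a ⟶ y.a
  comm : (X.map (δ 1)).map β ≫ y.α = x.α ≫ (X.map (δ 0)).map β

/-- The descent groupoid. -/
instance : Groupoid (Desc X) where
  Hom := Hom
  id x := ⟨𝟙 _, by simp⟩
  comp f g := ⟨f.β ≫ g.β, by simp [g.comm, reassoc_of% f.comm]⟩
  inv {x y} f := ⟨Groupoid.inv f.β, by
    rw [← cancel_epi ((X.map (δ 1)).map f.β), ← Functor.map_comp_assoc, reassoc_of% f.comm,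
      ← Functor.map_comp]
    simp⟩
  id_comp f := Hom.ext (Category.id_comp f.β)
  comp_id f := Hom.ext (Category.comp_id f.β)
  assoc f g h := Hom.ext (Category.assoc f.β g.β h.β)
  inv_comp f := Hom.ext (Groupoid.inv_comp f.β)
  comp_inv f := Hom.ext (Groupoid.comp_inv f.β)

lemma ext' {x y : Desc X} (h : x.a = y.a)
    (h' : x.α = eqToHom (by rw [h]) ≫ y.α ≫ eqToHom (by rw [h])) : x = y := by
  obtain ⟨a, α, _, _⟩ := x
  obtain ⟨b, α', _, _⟩ := y
  obtain rfl : a = b := h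
  simp at h'
  subst h'
  rfl

lemma comp_β {x y z : Desc X} (f : x ⟶ y) (g : y ⟶ z) : (f ≫ g).β = f.β ≫ g.β := rfl

lemma eqToHom_β {x y : Desc X} (h : x = y) :
    (eqToHom h : x ⟶ y).β = eqToHom (congrArg Desc.a h) := by
  subst h
  rfl

lemma app_obj (F : X ⟶ Y) {i j : SimplexCategory} (f : i ⟶ j) (a : X.obj i) :
    (Y.map f).obj ((F.app i).obj a) = (F.app j).obj ((X.map f).obj a) :=
  (Functor.congr_obj (F.naturality f) a).symm

lemma app_map (F : X ⟶ Y) {i j : SimplexCategory} (f : i ⟶ j) {a b : X.obj i} (φ : a ⟶ b) :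
    (Y.map f).map ((F.app i).map φ) = eqToHom (app_obj F f a) ≫
      (F.app j).map ((X.map f).map φ) ≫ eqToHom (app_obj F f b).symm :=
  Functor.congr_hom (F.naturality f).symm φ

/-- The object `(F a, F α)`. -/
@[simps]
def mapObj (F : X ⟶ Y) (x : Desc X) : Desc Y where
  a := (F.app ⦋0⦌).obj x.a
  α := eqToHom (app_obj F (δ 1) x.a) ≫ (F.app ⦋1⦌).map x.α ≫
    eqToHom (app_obj F (δ 0) x.a).symm
  unit := by
    simp [app_map, x.unit, eqToHom_map]
  cocycle := by
    have := congrArg (F.app ⦋2⦌).map x.cocycle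
    simp only [Functor.map_comp, eqToHom_map] at this
    simp only [Functor.map_comp, eqToHom_map]
    rw [app_map F (δ 2) x.α, app_map F (δ 0) x.α, app_map F (δ 1) x.α]
    simp [reassoc_of% this]

/-- The functor between descent groupoids induced by a morphism of cosimplicial groupoids. -/
def map (F : X ⟶ Y) : Desc X ⥤ Desc Y where
  obj := mapObj F
  map {x y} f := ⟨(F.app ⦋0⦌).map f.β, by
    have := congrArg (F.app ⦋1⦌).map f.comm
    simp only [Functor.map_comp] at this
    change (Y.map (δ 1)).map ((F.app ⦋0⦌).map f.β) ≫ eqToHom _ ≫ (F.app ⦋1⦌).map y.α ≫ eqToHom _ =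
      (eqToHom _ ≫ (F.app ⦋1⦌).map x.α ≫ eqToHom _) ≫ (Y.map (δ 0)).map ((F.app ⦋0⦌).map f.β)
    rw [app_map F (δ 1) f.β, app_map F (δ 0) f.β]
    simp [reassoc_of% this]⟩
  map_id x := Hom.ext ((F.app ⦋0⦌).map_id x.a)
  map_comp f g := Hom.ext ((F.app ⦋0⦌).map_comp f.β g.β)

end Desc

/-- The descent groupoid as a functor of the cosimplicial groupoid. -/
def descFunctor : (SimplexCategory ⥤ Grpd.{v, v}) ⥤ Grpd.{v, v} where
  obj X := Grpd.of (Desc X)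
  map F := Desc.map F
  map_id X := by
    refine CategoryTheory.Functor.ext (fun x => Desc.ext' rfl ?_) (fun x y f => Desc.Hom.ext ?_)
    · change 𝟙 _ ≫ x.α ≫ 𝟙 _ = 𝟙 _ ≫ x.α ≫ 𝟙 _
      rfl
    · rw [Desc.comp_β, Desc.comp_β, Desc.eqToHom_β, Desc.eqToHom_β]
      change f.β = 𝟙 _ ≫ f.β ≫ 𝟙 _
      simp
  map_comp {X Y Z} F G := by
    refine CategoryTheory.Functor.ext (fun x => Desc.ext' rfl ?_) (fun x y f => Desc.Hom.ext ?_)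
    · change eqToHom _ ≫ (G.app ⦋1⦌).map ((F.app ⦋1⦌).map x.α) ≫ eqToHom _ =
        eqToHom _ ≫ (eqToHom _ ≫ (G.app ⦋1⦌).map (eqToHom _ ≫ (F.app ⦋1⦌).map x.α ≫ eqToHom _) ≫
          eqToHom _) ≫ eqToHom _
      exact map_eqToHom_aux (A := Y.obj ⦋1⦌) (B := Z.obj ⦋1⦌) (G.app ⦋1⦌) ((F.app ⦋1⦌).map x.α)
        _ _ _ _ _ _ _ _
    · rw [Desc.comp_β, Desc.comp_β, Desc.eqToHom_β, Desc.eqToHom_β]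
      change (G.app ⦋0⦌).map ((F.app ⦋0⦌).map f.β) =
        𝟙 _ ≫ (G.app ⦋0⦌).map ((F.app ⦋0⦌).map f.β) ≫ 𝟙 _
      simp

end Descent

end

end HolimGrpd

open HolimGrpd

/-!
Maps from `B` to one of the equalizers are compatible families of functors `V(i) ⥤ Hom(B, X(i))`,
where `Hom` denotes hom groupoids, `V(i) = [i]` for the totalizations and `V(i) = Δ/i` for the
homotopy limit.  So natural transformations of such families induce maps of equalizers.

A compatible family of functors `[i] ⥤ Y(i)` is determined by its vertex at `[0]` and its edge at
`[1]`, and the relations that these have to satisfy come from `[2]`: families are descent data,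
whatever the truncation is.

The last vertex functors `Δ/i ⥤ [i]` induce the map to the homotopy limit.  For its homotopy
inverse note that `Δ/i` has a terminal object, so that a functor from `Δ/i` to a groupoid extends
uniquely to the codiscrete category on the objects of `Δ/i`, and restricts from there to the
vertices of `[i]`.  In the codiscrete category there is also a path from the last vertex of
`[j] ⟶ [i]` to the object `[j] ⟶ [i]` itself, which becomes the homotopy.

In a simplicial model category the ends of the cylinder of a cofibrant object are trivial
cofibrations, so that maps which are homotopic to the identity are weak equivalences, and hence so
are their retracts.
-/

universe w w' v''

namespace HolimGrpd

noncomputable section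

/-! ### Functors from codiscrete categories -/

section Codiscrete

variable {D : Type w} [Category.{v'} D] {t : D}

lemma codiscrete_functor_ext {E : Type u} [Category.{u'} E] (ht : IsTerminal t)
    {F F' : Codiscrete D ⥤ E} (h : Codiscrete.unitApp D ⋙ F = Codiscrete.unitApp D ⋙ F') :
    F = F' := by
  have hobj (d : Codiscrete D) : F.obj d = F'.obj d := Functor.congr_obj h d.as
  have map_to_terminal (d : Codiscrete D) : F.map (Codiscrete.iso d ⟨t⟩).hom =
      eqToHom (hobj d) ≫ F'.map (Codiscrete.iso d ⟨t⟩).hom ≫ eqToHom (hobj ⟨t⟩).symm :=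
    Functor.congr_hom h (ht.from d.as)
  refine CategoryTheory.Functor.ext hobj fun d d' f => ?_
  obtain rfl : f = (Codiscrete.iso d ⟨t⟩).hom ≫ inv (Codiscrete.iso d' ⟨t⟩).hom := rfl
  rw [F.map_comp, F'.map_comp, F.map_inv, F'.map_inv]
  simp only [map_to_terminal, IsIso.inv_comp, inv_eqToHom, Category.assoc, eqToHom_trans_assoc,
    eqToHom_refl, Category.id_comp]

variable {G : Type v} [Groupoid.{u'} G]

/-- The extension to the codiscrete category on the objects of `D` of a functor to a groupoid, for a
category `D` with a terminal object `t`: the morphism `d ⟶ d'` is sent to `F(d) ⟶ F(t) ⟵ F(d')`. -/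
def extendCodiscrete (ht : IsTerminal t) (F : D ⥤ G) : Codiscrete D ⥤ G where
  obj d := F.obj d.as
  map {d d'} _ := F.map (ht.from d.as) ≫ Groupoid.inv (F.map (ht.from d'.as))

lemma unitApp_extendCodiscrete (ht : IsTerminal t) (F : D ⥤ G) :
    Codiscrete.unitApp D ⋙ extendCodiscrete ht F = F := by
  refine CategoryTheory.Functor.ext (fun _ => rfl) fun d d' f => ?_
  change F.map (ht.from d) ≫ Groupoid.inv (F.map (ht.from d')) = 𝟙 _ ≫ F.map f ≫ 𝟙 _
  rw [← ht.comp_from f, F.map_comp]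
  simp

lemma extendCodiscrete_precomp {D' : Type w'} [Category.{v''} D'] {t' : D'} (ht : IsTerminal t)
    (ht' : IsTerminal t') (U : D' ⥤ D) (F : D ⥤ G) :
    extendCodiscrete ht' (U ⋙ F) = Codiscrete.functorOfFun U.obj ⋙ extendCodiscrete ht F :=
  codiscrete_functor_ext ht' <| (unitApp_extendCodiscrete ht' _).trans
    (congrArg (U ⋙ ·) (unitApp_extendCodiscrete ht F)).symm

lemma extendCodiscrete_postcomp {G' : Type u} [Groupoid.{w'} G'] (ht : IsTerminal t) (F : D ⥤ G)
    (U : G ⥤ G') : extendCodiscrete ht (F ⋙ U) = extendCodiscrete ht F ⋙ U :=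
  codiscrete_functor_ext ht <| (unitApp_extendCodiscrete ht _).trans
    (congrArg (· ⋙ U) (unitApp_extendCodiscrete ht F)).symm

end Codiscrete

/-! ### Paths in groupoids -/

section Interval

instance (α : Type w) : Groupoid (AsSmall.{v} (Codiscrete α)) where
  inv _ := ⟨⟨⟩⟩

/-- The groupoid with two objects and exactly one morphism between any two objects. -/
def interval : Grpd.{v, v} := Grpd.of (AsSmall.{v} (Codiscrete Bool))

/-- The endpoints of the interval. -/
def interval.pt (b : Bool) : interval.{v} := AsSmall.up.obj (Codiscrete.mk b)

/-- The morphism between the endpoints of the interval. -/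
def interval.arrow : interval.pt.{v} false ⟶ interval.pt true :=
  AsSmall.up.map (Codiscrete.iso _ _).hom

/-- The path groupoid `Fun(interval, G)`, as a functor of `G`. -/
abbrev grpdPath : Grpd.{v, v} ⥤ Grpd.{v, v} := grpdFun.obj (op interval)

/-- The evaluation of paths at an endpoint. -/
def grpdPathEnd (b : Bool) : grpdPath.{v} ⟶ 𝟭 Grpd.{v, v} where
  app G := (evaluation interval.{v} G).obj (interval.pt b)

end Interval

/-! ### Compatible families of functors -/

section Families

variable {I : Type} [SmallCategory I]

/-- A family of functors `V(i) ⥤ Y(i)`, over the `i` that satisfy `p`, which is compatible with the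
arrows in `Arr p q`.  For `Y = Hom(B, X)` these are the maps from `B` to the equalizer `eqz` whose
weights are the nerves of the `V(i)`. -/
@[ext]
structure FunctorFamily (V : I ⥤ Cat.{0, 0}) (p q : I → Prop) (Y : I ⥤ Grpd.{v, v}) where
  fn (i : {i : I // p i}) : V.obj i.1 ⥤ Y.obj i.1
  comm (a : Arr p q) : (V.map a.hom).toFunctor ⋙ fn ⟨a.tgt, a.tgt_mem⟩ =
    fn ⟨a.src, a.src_mem⟩ ⋙ (Y.map a.hom : Y.obj a.src ⥤ Y.obj a.tgt)

namespace FunctorFamily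

variable {V : I ⥤ Cat.{0, 0}} {p q : I → Prop} {Y Y' : I ⥤ Grpd.{v, v}}

/-- The family induced by `Y ⟶ Y'`. -/
def map (g : Y ⟶ Y') (F : FunctorFamily V p q Y) : FunctorFamily V p q Y' where
  fn i := F.fn i ⋙ (g.app i.1 : Y.obj i.1 ⥤ Y'.obj i.1)
  comm a := by
    have h : (Y.map a.hom ⋙ g.app a.tgt : Y.obj a.src ⥤ Y'.obj a.tgt) =
      g.app a.src ⋙ Y'.map a.hom := g.naturality a.hom
    rw [← Functor.assoc, F.comm, Functor.assoc, Functor.assoc, h]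

end FunctorFamily

/-- The families of functors `V(i) ⥤ Y(i)`, as a functor of `Y`. -/
@[simps]
def functorFamilies (V : I ⥤ Cat.{0, 0}) (p q : I → Prop) : (I ⥤ Grpd.{v, v}) ⥤ Type v where
  obj Y := FunctorFamily V p q Y
  map g := ↾FunctorFamily.map g

variable {V V' : I ⥤ Cat.{0, 0}}

/-- Precomposition of families with `V' ⟶ V`. -/
@[simps]
def precompFamilies (κ : V' ⟶ V) (p q : I → Prop) :
    functorFamilies.{v} V p q ⟶ functorFamilies V' p q where
  app Y := ↾fun F =>
    { fn i := (κ.app i.1).toFunctor ⋙ F.fn i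
      comm a := by
        have h := congrArg Cat.Hom.toFunctor (κ.naturality a.hom)
        rw [Cat.Hom.comp_toFunctor, Cat.Hom.comp_toFunctor] at h
        rw [← Functor.assoc, h, Functor.assoc, F.comm, Functor.assoc] }

variable (I) in
/-- The diagram `i ↦` codiscrete category on the objects of `I/i`. -/
def codiscreteOver : I ⥤ Cat.{0, 0} :=
  Over.mapFunctor I ⋙ Cat.objects ⋙ Codiscrete.functorToCat

/-- The extension of families on the categories `I/i` to the codiscrete categories on their
objects. -/
@[simps]
def extendFamilies (p q : I → Prop) :
    functorFamilies.{v} (Over.mapFunctor I) p q ⟶ functorFamilies (codiscreteOver I) p q where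
  app Y := ↾fun F =>
    { fn i := extendCodiscrete Over.mkIdTerminal (F.fn i)
      comm a := (extendCodiscrete_precomp Over.mkIdTerminal Over.mkIdTerminal (Over.map a.hom)
          (F.fn ⟨a.tgt, a.tgt_mem⟩)).symm.trans <|
        (congrArg (extendCodiscrete Over.mkIdTerminal) (F.comm a)).trans <|
          extendCodiscrete_postcomp _ _ _ }
  naturality Y Y' g := by
    ext F
    refine FunctorFamily.ext (funext fun i => ?_)
    exact extendCodiscrete_postcomp _ _ _

end Families

/-! ### Weights given by small categories -/

section Weights

variable {I : Type} [SmallCategory I]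

/-- A presentation of the weight `W` by the categories `V(i)`: the maps from `W(i)` to the nerve of
a groupoid are the functors from `V(i)`. -/
structure NerveWeight (W : I ⥤ SSet.{v}) (V : I ⥤ Cat.{0, 0}) where
  equiv (i : I) (G : Grpd.{v, v}) : (W.obj i ⟶ grpdNerve.obj G) ≃ (V.obj i ⥤ G)
  equiv_comp {i : I} {G G' : Grpd.{v, v}} (φ : W.obj i ⟶ grpdNerve.obj G) (g : G ⟶ G') :
    equiv i G' (φ ≫ grpdNerve.map g) = equiv i G φ ⋙ (g : G ⥤ G')
  equiv_map {i j : I} {G : Grpd.{v, v}} (f : j ⟶ i) (φ : W.obj i ⟶ grpdNerve.obj G) :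
    equiv j G (W.map f ≫ φ) = (V.map f).toFunctor ⋙ equiv i G φ

/-- The map from the nerve of a small category `D` to the nerve of `G` given by a functor; the nerve
of `D` has to be lifted to the universe of `G`. -/
def uliftNerveMap {D : Type} [SmallCategory D] {G : Type v} [SmallCategory G] (F : D ⥤ G) :
    SSet.uliftFunctor.{v, 0}.obj (nerve D) ⟶ nerve G where
  app _ := ↾fun x => (x.down ⋙ F : _ ⥤ G)

lemma uliftNerveMap_injective {D : Type} [SmallCategory D] {G : Type v} [SmallCategory G] :
    Function.Injective (uliftNerveMap (D := D) (G := G)) := by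
  intro F F' h
  have comp_eq (n : ℕ) (x : ComposableArrows D n) : x ⋙ F = x ⋙ F' :=
    congrArg (fun φ => φ.app (op ⦋n⦌) ⟨x⟩) h
  refine CategoryTheory.Functor.ext (fun d => ?_) (fun d d' f => ?_)
  · exact Functor.congr_obj (comp_eq 0 (ComposableArrows.mk₀ d)) 0
  · exact Functor.congr_hom (comp_eq 1 (ComposableArrows.mk₁ f)) (homOfLE (Fin.zero_le 1))

lemma uliftNerveMap_surjective {D : Type} [SmallCategory D] {G : Type v} [SmallCategory G] :
    Function.Surjective (uliftNerveMap (D := D) (G := G)) := by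
  intro φ
  let fromAsSmall : nerve (AsSmall.{v} D) ⟶ SSet.uliftFunctor.{v, 0}.obj (nerve D) :=
    { app _ := ↾fun x => ⟨(x ⋙ AsSmall.down : _ ⥤ D)⟩ }
  obtain ⟨F, hF⟩ := nerveFunctor.{v, v}.map_surjective (X := Cat.of (AsSmall.{v} D)) (Y := Cat.of G)
    (fromAsSmall ≫ φ)
  refine ⟨(AsSmall.up : D ⥤ AsSmall.{v} D) ⋙ F.toFunctor, ?_⟩
  ext n ⟨x⟩
  exact congrArg (fun ψ => ψ.app n (x ⋙ AsSmall.up)) hF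

/-- Maps from the nerve of a small category `D` to the nerve of `G` are functors. -/
def uliftNerveEquiv (D : Type) [SmallCategory D] (G : Type v) [SmallCategory G] :
    (D ⥤ G) ≃ (SSet.uliftFunctor.{v, 0}.obj (nerve D) ⟶ nerve G) :=
  Equiv.ofBijective uliftNerveMap ⟨uliftNerveMap_injective, uliftNerveMap_surjective⟩

/-- The weight given by the nerves of a diagram of small categories. -/
def nerveWeight (V : I ⥤ Cat.{0, 0}) :
    NerveWeight (V ⋙ nerveFunctor ⋙ SSet.uliftFunctor.{v, 0}) V where
  equiv i G := (uliftNerveEquiv (V.obj i) G).symm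
  equiv_comp {i G G'} φ g := by
    obtain ⟨F, rfl⟩ := (uliftNerveEquiv (V.obj i) G).surjective φ
    refine ((uliftNerveEquiv (V.obj i) G').symm_apply_eq).2 ?_
    exact congrArg (fun F => uliftNerveEquiv (V.obj i) G' (F ⋙ (g : G ⥤ G')))
      ((uliftNerveEquiv (V.obj i) G).symm_apply_apply F).symm
  equiv_map {i j G} f φ := by
    obtain ⟨F, rfl⟩ := (uliftNerveEquiv (V.obj i) G).surjective φ
    refine ((uliftNerveEquiv (V.obj j) G).symm_apply_eq).2 ?_
    exact congrArg (fun F => uliftNerveEquiv (V.obj j) G ((V.map f).toFunctor ⋙ F))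
      ((uliftNerveEquiv (V.obj i) G).symm_apply_apply F).symm

variable (I) in
/-- The weight `i ↦ N(I/i)` of the homotopy limit. -/
def overWeight : NerveWeight (overNerve.{v} I) (Over.mapFunctor I) :=
  nerveWeight _

/-- The weight `[n] ↦ Δ^n`: the maps from `Δ^n` to the nerve of `G` are the functors `[n] ⥤ G`. -/
def simplexWeight : NerveWeight simplices.{v} SimplexCategory.toCat where
  equiv n G := SSet.yonedaEquiv (X := grpdNerve.obj G) (n := n)
  equiv_comp _ _ := rfl
  equiv_map {i j _} f φ :=
    (uliftYonedaEquiv_naturality (X := op i) (Y := op j) φ f.op).symm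

end Weights

/-! ### Maps to the equalizers -/

section Lift

variable {C : Type u} [Category.{v} C] {I : Type} [SmallCategory I] {P : SSet.{v}ᵒᵖ ⥤ C ⥤ C}
  {W : I ⥤ SSet.{v}} {p q : I → Prop} [HasProducts.{0} C] [HasEqualizers C]

lemma eqz_hom_ext {X : I ⥤ C} {B : C} {f g : B ⟶ (eqz P W p q).obj X}
    (h : ∀ i, f ≫ eqzι P W p q X ≫ Pi.π _ i = g ≫ eqzι P W p q X ≫ Pi.π _ i) : f = g := by
  apply equalizer.hom_ext
  refine Pi.hom_ext _ _ fun i => ?_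
  exact (Category.assoc _ _ _).trans ((h i).trans (Category.assoc _ _ _).symm)

lemma eqz_condition (X : I ⥤ C) (a : Arr p q) :
    eqzι P W p q X ≫ Pi.π _ (⟨a.tgt, a.tgt_mem⟩ : {i : I // p i}) ≫
      (P.map (W.map a.hom).op).app (X.obj a.tgt) =
    eqzι P W p q X ≫ Pi.π _ (⟨a.src, a.src_mem⟩ : {i : I // p i}) ≫
      (P.obj (op (W.obj a.src))).map (X.map a.hom) := by
  have condition : eqzι P W p q X ≫ leftMap P W p q X = eqzι P W p q X ≫ rightMap P W p q X :=
    equalizer.condition _ _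
  have component := congrArg (· ≫ Pi.π _ a) condition
  simpa only [leftMap, rightMap, Category.assoc, Pi.lift_π] using component

/-- The map to the equalizer with the given components `B ⟶ X(i)^{W(i)}`. -/
def eqzLift {X : I ⥤ C} {B : C}
    (f : ∀ i : {i : I // p i}, B ⟶ (P.obj (op (W.obj i.1))).obj (X.obj i.1))
    (hf : ∀ a : Arr p q, f ⟨a.tgt, a.tgt_mem⟩ ≫ (P.map (W.map a.hom).op).app (X.obj a.tgt) =
      f ⟨a.src, a.src_mem⟩ ≫ (P.obj (op (W.obj a.src))).map (X.map a.hom)) :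
    B ⟶ (eqz P W p q).obj X :=
  equalizer.lift (Pi.lift f) <| Pi.hom_ext _ _ fun a => by simpa [leftMap, rightMap] using hf a

@[simp]
lemma eqzLift_π {X : I ⥤ C} {B : C}
    (f : ∀ i : {i : I // p i}, B ⟶ (P.obj (op (W.obj i.1))).obj (X.obj i.1)) (hf) (i) :
    eqzLift (q := q) f hf ≫ eqzι P W p q X ≫ Pi.π _ i = f i := by
  refine (Category.assoc _ _ _).symm.trans ?_
  exact (congrArg (· ≫ Pi.π _ i) (equalizer.lift_ι _ _)).trans (Pi.lift_π _ _)

lemma eqz_map_π {X X' : I ⥤ C} (x : X ⟶ X') (i : {i : I // p i}) :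
    (eqz P W p q).map x ≫ eqzι P W p q X' ≫ Pi.π _ i =
      eqzι P W p q X ≫ Pi.π _ i ≫ (P.obj (op (W.obj i.1))).map (x.app i.1) := by
  have map_ι : (eqz P W p q).map x ≫ eqzι P W p q X' = eqzι P W p q X ≫ prodObjMap P W p x :=
    equalizer.lift_ι _ _
  have component := congrArg (· ≫ Pi.π _ i) map_ι
  simpa only [prodObjMap, Category.assoc, Pi.map_π] using component

end Lift

/-! ### Cotensors that are represented by hom groupoids -/

section Represented

variable {C : Type u} [Category.{v} C]

/-- Hom groupoids for `C` with natural bijections between the maps `B ⟶ A^K` and the maps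
`K ⟶ N(Hom(B, A))`, where `A^K` is `(P.obj (op K)).obj A`. -/
structure GroupoidalCotensor (P : SSet.{v}ᵒᵖ ⥤ C ⥤ C) where
  hom : Cᵒᵖ ⥤ C ⥤ Grpd.{v, v}
  powEquiv (K : SSet.{v}) (A B : C) :
    (B ⟶ (P.obj (op K)).obj A) ≃ (K ⟶ grpdNerve.obj ((hom.obj (op B)).obj A))
  powEquiv_precomp {K : SSet.{v}} {A B B' : C} (b : B' ⟶ B) (f : B ⟶ (P.obj (op K)).obj A) :
    powEquiv K A B' (b ≫ f) = powEquiv K A B f ≫ grpdNerve.map ((hom.map b.op).app A)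
  powEquiv_postcomp {K : SSet.{v}} {A A' B : C} (a : A ⟶ A') (f : B ⟶ (P.obj (op K)).obj A) :
    powEquiv K A' B (f ≫ (P.obj (op K)).map a) =
      powEquiv K A B f ≫ grpdNerve.map ((hom.obj (op B)).map a)
  powEquiv_weight {K K' : SSet.{v}} {A B : C} (κ : K' ⟶ K) (f : B ⟶ (P.obj (op K)).obj A) :
    powEquiv K' A B (f ≫ (P.map κ.op).app A) = κ ≫ powEquiv K A B f

namespace GroupoidalCotensor

variable {P : SSet.{v}ᵒᵖ ⥤ C ⥤ C} (R : GroupoidalCotensor P)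

/-- Cylinder objects for the hom groupoids of `R`: a path in `Hom(B, A)` gives a map
`cyl B ⟶ A` between its ends. -/
structure Cylinder where
  obj : C → C
  ι (b : Bool) (B : C) : B ⟶ obj B
  lift (B : C) : R.hom.obj (op B) ⋙ grpdPath ⟶ R.hom.obj (op (obj B))
  lift_ι (b : Bool) (B A : C) : (lift B).app A ≫ (R.hom.map (ι b B).op).app A =
    (grpdPathEnd b).app _

variable {I : Type} [SmallCategory I] {W W' W'' : I ⥤ SSet.{v}} {V V' V'' : I ⥤ Cat.{0, 0}}
  (N : NerveWeight W V) (N' : NerveWeight W' V') (N'' : NerveWeight W'' V'')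
  {p q p' q' p'' q'' : I → Prop}

/-- The functor `V(i) ⥤ Hom(B, A)` that corresponds to `B ⟶ A^{W(i)}`. -/
def weightEquiv (i : I) (A B : C) :
    (B ⟶ (P.obj (op (W.obj i))).obj A) ≃ (V.obj i ⥤ (R.hom.obj (op B)).obj A) :=
  (R.powEquiv _ _ _).trans (N.equiv i _)

lemma weightEquiv_precomp (i : I) {A B B' : C} (b : B' ⟶ B)
    (f : B ⟶ (P.obj (op (W.obj i))).obj A) :
    R.weightEquiv N i A B' (b ≫ f) = R.weightEquiv N i A B f ⋙
      ((R.hom.map b.op).app A : (R.hom.obj (op B)).obj A ⥤ (R.hom.obj (op B')).obj A) := by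
  dsimp only [weightEquiv, Equiv.trans_apply]
  rw [R.powEquiv_precomp, N.equiv_comp]

lemma weightEquiv_postcomp (i : I) {A A' B : C} (a : A ⟶ A')
    (f : B ⟶ (P.obj (op (W.obj i))).obj A) :
    R.weightEquiv N i A' B (f ≫ (P.obj (op (W.obj i))).map a) = R.weightEquiv N i A B f ⋙
      ((R.hom.obj (op B)).map a : (R.hom.obj (op B)).obj A ⥤ (R.hom.obj (op B)).obj A') := by
  dsimp only [weightEquiv, Equiv.trans_apply]
  rw [R.powEquiv_postcomp, N.equiv_comp]

lemma weightEquiv_weight {i j : I} (κ : j ⟶ i) {A B : C}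
    (f : B ⟶ (P.obj (op (W.obj i))).obj A) :
    R.weightEquiv N j A B (f ≫ (P.map (W.map κ).op).app A) =
      (V.map κ).toFunctor ⋙ R.weightEquiv N i A B f := by
  dsimp only [weightEquiv, Equiv.trans_apply]
  rw [R.powEquiv_weight, N.equiv_map]

variable [HasProducts.{0} C] [HasEqualizers C]

/-- Maps to the equalizer are compatible families of functors. -/
def eqzHomEquiv (X : I ⥤ C) (B : C) :
    (B ⟶ (eqz P W p q).obj X) ≃ (functorFamilies V p q).obj (X ⋙ R.hom.obj (op B)) where
  toFun f :=
    { fn i := R.weightEquiv N i.1 (X.obj i.1) B (f ≫ eqzι P W p q X ≫ Pi.π _ i)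
      comm a := by
        refine (R.weightEquiv_weight N a.hom _).symm.trans ?_
        refine Eq.trans ?_ (R.weightEquiv_postcomp N a.src (X.map a.hom) _)
        simp only [Category.assoc, eqz_condition] }
  invFun F := eqzLift (fun i => (R.weightEquiv N i.1 (X.obj i.1) B).symm (F.fn i)) fun a => by
    apply (R.weightEquiv N _ _ _).injective
    rw [weightEquiv_weight, weightEquiv_postcomp, Equiv.apply_symm_apply, Equiv.apply_symm_apply]
    exact F.comm a
  left_inv f := eqz_hom_ext fun i => by simp
  right_inv F := FunctorFamily.ext <| funext fun i => by simp

lemma eqzHomEquiv_precomp (X : I ⥤ C) {B B' : C} (b : B' ⟶ B)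
    (f : B ⟶ (eqz P W p q).obj X) :
    R.eqzHomEquiv N X B' (b ≫ f) = (functorFamilies V p q).map
      (Functor.whiskerLeft X (R.hom.map b.op)) (R.eqzHomEquiv N X B f) := by
  refine FunctorFamily.ext (funext fun i => ?_)
  exact (congrArg _ (Category.assoc _ _ _)).trans (R.weightEquiv_precomp N i.1 b _)

lemma eqzHomEquiv_postcomp {X X' : I ⥤ C} (x : X ⟶ X') {B : C}
    (f : B ⟶ (eqz P W p q).obj X) :
    R.eqzHomEquiv N X' B (f ≫ (eqz P W p q).map x) = (functorFamilies V p q).map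
      (Functor.whiskerRight x (R.hom.obj (op B))) (R.eqzHomEquiv N X B f) := by
  refine FunctorFamily.ext (funext fun i => ?_)
  refine (congrArg _ ?_).trans (R.weightEquiv_postcomp N i.1 (x.app i.1) _)
  simp only [Category.assoc, eqz_map_π]

/-- The map of equalizers induced by a natural transformation of family functors. -/
def eqzTrans (T : functorFamilies.{v} V p q ⟶ functorFamilies V' p' q') :
    eqz P W p q ⟶ eqz P W' p' q' where
  app X := (R.eqzHomEquiv N' X _).symm (T.app _ (R.eqzHomEquiv N X _ (𝟙 _)))
  naturality X X' x := by
    apply (R.eqzHomEquiv N' X' _).injective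
    rw [eqzHomEquiv_precomp, eqzHomEquiv_postcomp, Equiv.apply_symm_apply, Equiv.apply_symm_apply,
      ← NatTrans.naturality_apply, ← NatTrans.naturality_apply, ← eqzHomEquiv_precomp,
      ← eqzHomEquiv_postcomp, Category.id_comp, Category.comp_id]

lemma eqzHomEquiv_comp_eqzTrans (T : functorFamilies.{v} V p q ⟶ functorFamilies V' p' q')
    {X : I ⥤ C} {B : C} (f : B ⟶ (eqz P W p q).obj X) :
    R.eqzHomEquiv N' X B (f ≫ (R.eqzTrans N N' T).app X) =
      T.app _ (R.eqzHomEquiv N X B f) := by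
  rw [eqzHomEquiv_precomp, eqzTrans, Equiv.apply_symm_apply, ← NatTrans.naturality_apply,
    ← eqzHomEquiv_precomp, Category.comp_id]

lemma eqzTrans_id : R.eqzTrans N N (𝟙 (functorFamilies.{v} V p q)) = 𝟙 (eqz P W p q) := by
  ext X
  exact (R.eqzHomEquiv N X _).symm_apply_apply _

lemma eqzTrans_comp (T : functorFamilies.{v} V p q ⟶ functorFamilies V' p' q')
    (T' : functorFamilies.{v} V' p' q' ⟶ functorFamilies V'' p'' q'') :
    R.eqzTrans N N' T ≫ R.eqzTrans N' N'' T' =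
      (R.eqzTrans N N'' (T ≫ T') : eqz P W p q ⟶ eqz P W'' p'' q'') := by
  ext X
  apply (R.eqzHomEquiv N'' X _).injective
  rw [NatTrans.comp_app, eqzHomEquiv_comp_eqzTrans]
  simp [eqzTrans]

/-- The isomorphism of equalizers induced by an isomorphism of family functors. -/
@[simps]
def eqzIso (T : functorFamilies.{v} V p q ≅ functorFamilies V' p' q') :
    eqz P W p q ≅ eqz P W' p' q' where
  hom := R.eqzTrans N N' T.hom
  inv := R.eqzTrans N' N T.inv
  hom_inv_id := by rw [eqzTrans_comp, T.hom_inv_id, eqzTrans_id]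
  inv_hom_id := by rw [eqzTrans_comp, T.inv_hom_id, eqzTrans_id]

lemma eqzTrans_app_π (T : functorFamilies.{v} V p q ⟶ functorFamilies V p' q') {i : I} (hi : p i)
    (hi' : p' i) (hT : ∀ Y F, (T.app Y F).fn ⟨i, hi'⟩ = F.fn ⟨i, hi⟩) (X : I ⥤ C) :
    (R.eqzTrans N N T).app X ≫ eqzι P W p' q' X ≫ Pi.π _ ⟨i, hi'⟩ =
      eqzι P W p q X ≫ Pi.π _ ⟨i, hi⟩ := by
  apply (R.weightEquiv N i (X.obj i) _).injective
  have component := congrArg (fun F => F.fn ⟨i, hi'⟩)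
    (R.eqzHomEquiv_comp_eqzTrans N N T (X := X) (𝟙 _))
  rw [Category.id_comp] at component
  exact component.trans <| (hT _ _).trans <|
    congrArg (R.weightEquiv N i (X.obj i) _) (Category.id_comp _)

lemma exists_cylinder_of_grpdPath (Z : R.Cylinder) {X : I ⥤ C} {B : C}
    (f : Bool → (B ⟶ (eqz P W p q).obj X))
    (H : (functorFamilies V p q).obj ((X ⋙ R.hom.obj (op B)) ⋙ grpdPath))
    (hH : ∀ b, (functorFamilies V p q).map (Functor.whiskerLeft _ (grpdPathEnd b)) H =
      R.eqzHomEquiv N X B (f b)) :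
    ∃ h : Z.obj B ⟶ (eqz P W p q).obj X, ∀ b, Z.ι b B ≫ h = f b := by
  refine ⟨(R.eqzHomEquiv N X _).symm ((functorFamilies V p q).map
    (Functor.whiskerLeft X (Z.lift B)) H), fun b => (R.eqzHomEquiv N X B).injective ?_⟩
  rw [eqzHomEquiv_precomp, Equiv.apply_symm_apply, ← hH]
  refine FunctorFamily.ext (funext fun i => ?_)
  exact congrArg (fun g => H.fn i ⋙ g) (Z.lift_ι b B (X.obj i))

end GroupoidalCotensor

end Represented

/-! ### Simplices and the categories `Δ/n` -/

section LastVertex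

/-- The last vertex functors `Δ/n ⥤ [n]`. -/
def lastVertex : Over.mapFunctor SimplexCategory ⟶ SimplexCategory.toCat where
  app n := Functor.toCatHom (C := Over n) (D := Fin (n.len + 1))
    { obj x := x.hom.toOrderHom (Fin.last _)
      map {x x'} g := homOfLE (by
        rw [← Over.w g]
        exact x'.hom.toOrderHom.monotone (Fin.le_last _)) }
  naturality _ _ _ := rfl

/-- The vertices of `[n]`, as a functor to the codiscrete category on the objects of `Δ/n`. -/
def vertices : SimplexCategory.toCat ⟶ codiscreteOver SimplexCategory where
  app n := Functor.toCatHom (C := Fin (n.len + 1)) (D := Codiscrete (Over n))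
    (Codiscrete.functor fun k => Over.mk (SimplexCategory.const ⦋0⦌ n k))
  naturality _ _ _ := rfl

/-- The family on the categories `Δ/n` induced by a family on the categories `[n]`. -/
def simplexToOver (p q : SimplexCategory → Prop) :
    functorFamilies.{v} SimplexCategory.toCat p q ⟶
      functorFamilies (Over.mapFunctor SimplexCategory) p q :=
  precompFamilies lastVertex p q

/-- The family on the categories `[n]` given by a family on the categories `Δ/n`: its extension to
the codiscrete categories, restricted to the vertices. -/
def overToSimplex (p q : SimplexCategory → Prop) :
    functorFamilies.{v} (Over.mapFunctor SimplexCategory) p q ⟶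
      functorFamilies SimplexCategory.toCat p q :=
  extendFamilies p q ≫ precompFamilies vertices p q

lemma simplexToOver_overToSimplex (p q : SimplexCategory → Prop) :
    simplexToOver.{v} p q ≫ overToSimplex p q = 𝟙 _ := by
  ext Y F
  refine FunctorFamily.ext (funext fun n => ?_)
  have isTerminalLast : IsTerminal (Fin.last n.1.len : Fin (n.1.len + 1)) := isTerminalTop
  refine Eq.trans ?_ (unitApp_extendCodiscrete (D := Fin (n.1.len + 1)) isTerminalLast (F.fn n))
  exact congrArg ((vertices.app n.1).toFunctor ⋙ ·) <| extendCodiscrete_precomp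
    (D := Fin (n.1.len + 1)) isTerminalLast Over.mkIdTerminal (lastVertex.app n.1).toFunctor _

/-- The paths from the last vertex of `[m] ⟶ [n]` to `[m] ⟶ [n]`. -/
def lastVertexPath (n : SimplexCategory) : Over n ⥤ (interval.{v} ⥤ Codiscrete (Over n)) where
  obj x := AsSmall.down ⋙ Codiscrete.functorOfFun fun b : Bool =>
    if b then x else Over.mk (SimplexCategory.const ⦋0⦌ n (x.hom.toOrderHom (Fin.last _)))
  map _ := { app _ := ⟨⟩ }

lemma map_lastVertexPath {n m : SimplexCategory} (f : n ⟶ m) :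
    Over.map f ⋙ lastVertexPath.{v} m = lastVertexPath n ⋙
      (Functor.whiskeringRight interval.{v} _ _).obj
        ((codiscreteOver SimplexCategory).map f).toFunctor := by
  refine CategoryTheory.Functor.ext (fun x => ?_) fun _ _ _ => rfl
  refine CategoryTheory.Functor.ext (fun b => ?_) fun _ _ _ => rfl
  obtain ⟨⟨_ | _⟩⟩ := b <;> rfl

variable {Y : SimplexCategory ⥤ Grpd.{v, v}} {p q : SimplexCategory → Prop}

/-- The image of the paths from the last vertex under a family on the categories `Δ/n`. -/
def lastVertexPathFamily (F : FunctorFamily (Over.mapFunctor SimplexCategory) p q Y) :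
    FunctorFamily (Over.mapFunctor SimplexCategory) p q (Y ⋙ grpdPath) where
  fn n := lastVertexPath n.1 ⋙ (Functor.whiskeringRight interval.{v} (Codiscrete (Over n.1))
    (Y.obj n.1)).obj (((extendFamilies p q).app Y F).fn n)
  comm a :=
    (congrArg (· ⋙ (Functor.whiskeringRight interval.{v} (Codiscrete (Over a.tgt))
      (Y.obj a.tgt)).obj (((extendFamilies p q).app Y F).fn ⟨a.tgt, a.tgt_mem⟩))
      (map_lastVertexPath a.hom)).trans <|
    congrArg (fun U => lastVertexPath a.src ⋙ (Functor.whiskeringRight interval.{v}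
      (Codiscrete (Over a.src)) (Y.obj a.tgt)).obj U) (((extendFamilies p q).app Y F).comm a)

lemma lastVertexPathFamily_false (F : FunctorFamily (Over.mapFunctor SimplexCategory) p q Y) :
    (lastVertexPathFamily F).map (Functor.whiskerLeft Y (grpdPathEnd false)) =
      (overToSimplex p q ≫ simplexToOver p q).app Y F :=
  rfl

lemma lastVertexPathFamily_true (F : FunctorFamily (Over.mapFunctor SimplexCategory) p q Y) :
    (lastVertexPathFamily F).map (Functor.whiskerLeft Y (grpdPathEnd true)) = F :=
  FunctorFamily.ext (funext fun _ => unitApp_extendCodiscrete _ _)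

end LastVertex

/-! ### Descent data and families of simplices -/

section DescentData

open SimplexCategory

variable {Y Y' : SimplexCategory ⥤ Grpd.{v, v}} {p q : SimplexCategory → Prop}

lemma map_obj_comp (Y : SimplexCategory ⥤ Grpd.{v, v}) {i j k : SimplexCategory} (f : i ⟶ j)
    (g : j ⟶ k) {h : i ⟶ k} (w : f ≫ g = h) (a : Y.obj i) :
    (Y.map h).obj a = (Y.map g).obj ((Y.map f).obj a) := by
  subst w
  exact Functor.congr_obj (Y.map_comp f g) a

lemma map_map_comp (Y : SimplexCategory ⥤ Grpd.{v, v}) {i j k : SimplexCategory} (f : i ⟶ j)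
    (g : j ⟶ k) {h : i ⟶ k} (w : f ≫ g = h) {a b : Y.obj i} (φ : a ⟶ b) :
    (Y.map h).map φ = eqToHom (map_obj_comp Y f g w a) ≫
      (Y.map g).map ((Y.map f).map φ) ≫ eqToHom (map_obj_comp Y f g w b).symm := by
  subst w
  exact Functor.congr_hom (Y.map_comp f g) φ

lemma eqToHom_conj_conj_conj {D : Type u'} [Category.{v'} D] {a₀ a₁ a₂ a₃ b₀ b₁ b₂ b₃ : D}
    (φ : a₃ ⟶ b₃) (h₁ : a₀ = a₁) (h₂ : a₁ = a₂) (h₃ : a₂ = a₃) (h₄ : b₃ = b₂) (h₅ : b₂ = b₁)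
    (h₆ : b₁ = b₀) (h₇ : a₀ = a₃) (h₈ : b₃ = b₀) :
    eqToHom h₁ ≫ (eqToHom h₂ ≫ (eqToHom h₃ ≫ φ ≫ eqToHom h₄) ≫ eqToHom h₅) ≫ eqToHom h₆ =
      eqToHom h₇ ≫ φ ≫ eqToHom h₈ := by
  simp

lemma source_mkOfLe {n : SimplexCategory} {k l : Fin (n.len + 1)} (h : k ≤ l) :
    δ 1 ≫ mkOfLe (n := n.len) k l h = const ⦋0⦌ n k := by
  ext i
  fin_cases i
  rfl

lemma target_mkOfLe {n : SimplexCategory} {k l : Fin (n.len + 1)} (h : k ≤ l) :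
    δ 0 ≫ mkOfLe (n := n.len) k l h = const ⦋0⦌ n l := by
  ext i
  fin_cases i
  rfl

namespace Desc

/-- The morphism of `Y^n` that descent data attach to an edge of the simplex `[n]`, with the
vertices of the edge as parameters to avoid casts. -/
def edge (x : Desc Y) {n : SimplexCategory} (e : ⦋1⦌ ⟶ n) {f g : ⦋0⦌ ⟶ n} (hf : δ 1 ≫ e = f)
    (hg : δ 0 ≫ e = g) : (Y.map f).obj x.a ⟶ (Y.map g).obj x.a :=
  eqToHom (map_obj_comp Y (δ 1) e hf x.a) ≫ (Y.map e).map x.α ≫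
    eqToHom (map_obj_comp Y (δ 0) e hg x.a).symm

lemma edge_eq_map_edge (x : Desc Y) {n m : SimplexCategory} {e : ⦋1⦌ ⟶ n} {f g : ⦋0⦌ ⟶ n}
    {hf : δ 1 ≫ e = f} {hg : δ 0 ≫ e = g} {t : n ⟶ m} {e' : ⦋1⦌ ⟶ m} {f' g' : ⦋0⦌ ⟶ m}
    {hf' : δ 1 ≫ e' = f'} {hg' : δ 0 ≫ e' = g'} (he : e ≫ t = e')
    (hft : f ≫ t = f') (hgt : g ≫ t = g') :
    x.edge e' hf' hg' = eqToHom (map_obj_comp Y f t hft x.a) ≫ (Y.map t).map (x.edge e hf hg) ≫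
      eqToHom (map_obj_comp Y g t hgt x.a).symm := by
  simp only [edge, Functor.map_comp, eqToHom_map, map_map_comp Y e t he x.α]
  simp

lemma edge_degenerate (x : Desc Y) {n : SimplexCategory} {f : ⦋0⦌ ⟶ n} {e : ⦋1⦌ ⟶ n}
    (he : σ 0 ≫ f = e) (hf : δ 1 ≫ e = f) (hg : δ 0 ≫ e = f) :
    x.edge e hf hg = 𝟙 _ := by
  rw [edge, map_map_comp Y (σ 0) f he x.α, x.unit, eqToHom_map]
  simp

lemma edge_comp (x : Desc Y) {n : SimplexCategory} (t : ⦋2⦌ ⟶ n) {e₀ e₁ e₂ : ⦋1⦌ ⟶ n}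
    (h₀ : δ 0 ≫ t = e₀) (h₁ : δ 1 ≫ t = e₁) (h₂ : δ 2 ≫ t = e₂) {f₀ f₁ f₂ : ⦋0⦌ ⟶ n}
    (h₂₁ : δ 1 ≫ e₂ = f₀) (h₂₀ : δ 0 ≫ e₂ = f₁) (h₀₁ : δ 1 ≫ e₀ = f₁) (h₀₀ : δ 0 ≫ e₀ = f₂)
    (h₁₁ : δ 1 ≫ e₁ = f₀) (h₁₀ : δ 0 ≫ e₁ = f₂) :
    x.edge e₂ h₂₁ h₂₀ ≫ x.edge e₀ h₀₁ h₀₀ = x.edge e₁ h₁₁ h₁₀ := by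
  have cocycle := congrArg (Y.map t).map x.cocycle
  simp only [Functor.map_comp, eqToHom_map] at cocycle
  simp only [edge, map_map_comp Y _ t h₀, map_map_comp Y _ t h₁, map_map_comp Y _ t h₂]
  simp [reassoc_of% cocycle]

/-- The functor `[n] ⥤ Y^n` given by descent data. -/
def simplexFunctor (x : Desc Y) (n : SimplexCategory) : Fin (n.len + 1) ⥤ Y.obj n where
  obj k := (Y.map (const ⦋0⦌ n k)).obj x.a
  map {k l} h := x.edge (mkOfLe (n := n.len) k l (leOfHom h)) (source_mkOfLe _) (target_mkOfLe _)
  map_id k := x.edge_degenerate (by ext i; fin_cases i <;> rfl) _ _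
  map_comp {k l m} h h' := (x.edge_comp (mkOfLeComp (n := n.len) k l m (leOfHom h) (leOfHom h'))
    (by ext i; fin_cases i <;> rfl) (by ext i; fin_cases i <;> rfl)
    (by ext i; fin_cases i <;> rfl) _ _ _ _ _ _).symm

/-- The family of simplices given by descent data. -/
@[simps]
def toFamily (x : Desc Y) (p q : SimplexCategory → Prop) : FunctorFamily toCat p q Y where
  fn n := x.simplexFunctor n.1
  comm a := CategoryTheory.Functor.ext
    (fun k : Fin (a.src.len + 1) => map_obj_comp Y (const ⦋0⦌ a.src k) a.hom rfl x.a)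
    (fun (k l : Fin (a.src.len + 1)) h =>
      x.edge_eq_map_edge (e := mkOfLe (n := a.src.len) k l (leOfHom h))
        (hf := source_mkOfLe (leOfHom h)) (hg := target_mkOfLe (leOfHom h))
        (hf' := source_mkOfLe (n := a.tgt) (a.hom.toOrderHom.monotone (leOfHom h)))
        (hg' := target_mkOfLe (n := a.tgt) (a.hom.toOrderHom.monotone (leOfHom h)))
        (by ext i; fin_cases i <;> rfl) rfl rfl)

end Desc

namespace FunctorFamily

/-- The member `[n] ⥤ Y^n` of a family of simplices. -/
def simplex (F : FunctorFamily toCat p q Y) (n : SimplexCategory) (hn : p n) :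
    Fin (n.len + 1) ⥤ Y.obj n :=
  F.fn ⟨n, hn⟩

lemma map_simplex_obj (F : FunctorFamily toCat p q Y) {i j : SimplexCategory} (f : j ⟶ i)
    (hj : p j) (hj' : q j) (hi : p i) (k : Fin (j.len + 1)) {l : Fin (i.len + 1)}
    (hl : f.toOrderHom k = l) :
    (Y.map f).obj ((F.simplex j hj).obj k) = (F.simplex i hi).obj l := by
  subst hl
  exact (Functor.congr_obj (F.comm ⟨j, i, f, hj, hj', hi⟩) k).symm

lemma map_simplex_map (F : FunctorFamily toCat p q Y) {i j : SimplexCategory} (f : j ⟶ i)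
    (hj : p j) (hj' : q j) (hi : p i) {k k' : Fin (j.len + 1)} (h : k ⟶ k')
    {l l' : Fin (i.len + 1)} (h' : l ⟶ l') (hl : f.toOrderHom k = l)
    (hl' : f.toOrderHom k' = l') :
    (Y.map f).map ((F.simplex j hj).map h) =
      eqToHom (F.map_simplex_obj f hj hj' hi k hl) ≫ (F.simplex i hi).map h' ≫
        eqToHom (F.map_simplex_obj f hj hj' hi k' hl').symm := by
  subst hl hl'
  exact Functor.congr_hom (F.comm ⟨j, i, f, hj, hj', hi⟩).symm h

variable (hp : ∀ n ≤ 2, p ⦋n⦌) (hq : ∀ n ≤ 1, q ⦋n⦌)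

/-- The descent data given by a family of simplices. -/
def toDesc (F : FunctorFamily toCat p q Y) : Desc Y where
  a := (F.simplex ⦋0⦌ (hp 0 (by lia))).obj (0 : Fin 1)
  α := eqToHom (F.map_simplex_obj (δ 1) (hp 0 (by lia)) (hq 0 (by lia)) (hp 1 (by lia)) (0 : Fin 1)
      (l := (0 : Fin 2)) rfl) ≫
    (F.simplex ⦋1⦌ (hp 1 (by lia))).map (homOfLE (by decide) : (0 : Fin 2) ⟶ 1) ≫
    eqToHom (F.map_simplex_obj (δ 0) (hp 0 (by lia)) (hq 0 (by lia)) (hp 1 (by lia)) (0 : Fin 1)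
      (l := (1 : Fin 2)) rfl).symm
  unit := by
    simp only [Functor.map_comp, eqToHom_map]
    rw [F.map_simplex_map (σ 0) (hp 1 (by lia)) (hq 1 (by lia)) (hp 0 (by lia)) _ (𝟙 (0 : Fin 1))
      rfl rfl]
    simp
  cocycle := by
    simp only [Functor.map_comp, eqToHom_map]
    rw [F.map_simplex_map (δ 0) (hp 1 (by lia)) (hq 1 (by lia)) (hp 2 (by lia)) _
        (homOfLE (by decide) : (1 : Fin 3) ⟶ 2) rfl rfl,
      F.map_simplex_map (δ 1) (hp 1 (by lia)) (hq 1 (by lia)) (hp 2 (by lia)) _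
        ((homOfLE (by decide) : (0 : Fin 3) ⟶ 1) ≫ (homOfLE (by decide) : (1 : Fin 3) ⟶ 2)) rfl rfl,
      F.map_simplex_map (δ 2) (hp 1 (by lia)) (hq 1 (by lia)) (hp 2 (by lia)) _
        (homOfLE (by decide) : (0 : Fin 3) ⟶ 1) rfl rfl]
    simp only [Functor.map_comp, Category.assoc, eqToHom_trans_assoc, eqToHom_refl,
      Category.id_comp, eqToHom_trans]

lemma toDesc_map (g : Y ⟶ Y') (F : FunctorFamily toCat p q Y) :
    (F.map g).toDesc hp hq = Desc.mapObj g (F.toDesc hp hq) :=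
  Desc.ext' rfl <| map_eqToHom_aux (A := Y.obj ⦋1⦌) (B := Y'.obj ⦋1⦌) (g.app ⦋1⦌)
    ((F.simplex ⦋1⦌ (hp 1 (by lia))).map (homOfLE (by decide) : (0 : Fin 2) ⟶ 1)) _ _ _ _ _ _ _ _

lemma toFamily_toDesc (F : FunctorFamily toCat p q Y) : (F.toDesc hp hq).toFamily p q = F := by
  refine FunctorFamily.ext (funext fun n => ?_)
  refine CategoryTheory.Functor.ext (fun (k : Fin (n.1.len + 1)) => ?_)
    (fun (k l : Fin (n.1.len + 1)) h => ?_)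
  · exact F.map_simplex_obj _ (hp 0 (by lia)) (hq 0 (by lia)) _ _ rfl
  · change Desc.edge _ _ (source_mkOfLe (leOfHom h)) (target_mkOfLe (leOfHom h)) =
      eqToHom _ ≫ (F.simplex n.1 n.2).map h ≫ eqToHom _
    dsimp only [Desc.edge, toDesc]
    simp only [Functor.map_comp, eqToHom_map]
    rw [F.map_simplex_map _ (hp 1 (by lia)) (hq 1 (by lia)) n.2 _ h rfl rfl]
    simp

lemma toDesc_toFamily (x : Desc Y) : (x.toFamily p q).toDesc hp hq = x := by
  have vertex_eq : const ⦋0⦌ ⦋0⦌ 0 = 𝟙 _ := by ext i; fin_cases i; rfl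
  have edge_eq (e : ⦋1⦌ ⟶ ⦋1⦌) (he : e = 𝟙 _) : (Y.map e).map x.α =
      eqToHom (by rw [he, Y.map_id]; rfl) ≫ x.α ≫ eqToHom (by rw [he, Y.map_id]; rfl) := by
    subst he
    exact Functor.congr_hom (Y.map_id _) x.α
  refine Desc.ext' ?_ ?_
  · change (Y.map (const ⦋0⦌ ⦋0⦌ 0)).obj x.a = x.a
    rw [vertex_eq]
    exact Functor.congr_obj (Y.map_id _) x.a
  · change eqToHom _ ≫ Desc.edge _ _ (source_mkOfLe (n := ⦋1⦌) (k := 0) (l := 1) (by decide))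
      (target_mkOfLe _) ≫ eqToHom _ = _
    rw [Desc.edge, edge_eq _ (by ext i; fin_cases i <;> rfl)]
    exact eqToHom_conj_conj_conj x.α _ _ _ _ _ _ _ _

end FunctorFamily

/-- Families of simplices are descent data. -/
def familiesIsoDesc (hp : ∀ n ≤ 2, p ⦋n⦌) (hq : ∀ n ≤ 1, q ⦋n⦌) :
    functorFamilies.{v} toCat p q ≅ descFunctor ⋙ Grpd.forgetToCat ⋙ Cat.objects :=
  NatIso.ofComponents
    (fun Y => Equiv.toIso
      { toFun F := FunctorFamily.toDesc hp hq F
        invFun x := Desc.toFamily x p q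
        left_inv F := F.toFamily_toDesc hp hq
        right_inv x := FunctorFamily.toDesc_toFamily hp hq x })
    (fun g => by
      ext F
      exact FunctorFamily.toDesc_map hp hq g F)

end DescentData

/-! ### Comparison with the homotopy limit -/

section Comparison

open SimplexCategory

/-- The families of simplices do not depend on the truncation. -/
def simplexFamiliesIso {p q p' q' : SimplexCategory → Prop} (hp : ∀ n ≤ 2, p ⦋n⦌)
    (hq : ∀ n ≤ 1, q ⦋n⦌) (hp' : ∀ n ≤ 2, p' ⦋n⦌) (hq' : ∀ n ≤ 1, q' ⦋n⦌) :
    functorFamilies.{v} toCat p q ≅ functorFamilies toCat p' q' :=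
  familiesIsoDesc hp hq ≪≫ (familiesIsoDesc hp' hq').symm

lemma simplexFamiliesIso_hom_fn {p q p' q' : SimplexCategory → Prop} (hp : ∀ n ≤ 2, p ⦋n⦌)
    (hq : ∀ n ≤ 1, q ⦋n⦌) (hp' : ∀ n ≤ 2, p' ⦋n⦌) (hq' : ∀ n ≤ 1, q' ⦋n⦌) {n : SimplexCategory}
    (hn : p n) (hn' : p' n) {Y : SimplexCategory ⥤ Grpd.{v, v}} (F : FunctorFamily toCat p q Y) :
    FunctorFamily.fn ((simplexFamiliesIso hp hq hp' hq').hom.app Y F) ⟨n, hn'⟩ = F.fn ⟨n, hn⟩ :=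
  congrArg (fun F' => F'.fn ⟨n, hn⟩) (F.toFamily_toDesc hp hq)

/-- Only the simplices of dimension at most `2`, and the maps between them from simplices of
dimension at most `1`, matter for families of simplices. -/
def truncFamiliesIso {n m : ℕ} (hn : 2 ≤ n) (hm : 1 ≤ m) :
    functorFamilies.{v} toCat (fun i => i.len ≤ n) (fun j => j.len ≤ m) ≅
      functorFamilies toCat (fun _ => True) (fun _ => True) :=
  simplexFamiliesIso (fun _ h => h.trans hn) (fun _ h => h.trans hm) (fun _ _ => trivial)
    (fun _ _ => trivial)

namespace GroupoidalCotensor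

variable {C : Type u} [Category.{v} C] {P : SSet.{v}ᵒᵖ ⥤ C ⥤ C} (R : GroupoidalCotensor P)
  [HasProducts.{0} C] [HasEqualizers C] {n m n' m' : ℕ} (hn : 2 ≤ n) (hm : 1 ≤ m) (hn' : 2 ≤ n')
  (hm' : 1 ≤ m')

/-- The truncated totalizations are isomorphic. -/
def truncTotIso : truncTot P n m ≅ truncTot P n' m' :=
  R.eqzIso simplexWeight simplexWeight <|
    simplexFamiliesIso (fun _ h => h.trans hn) (fun _ h => h.trans hm) (fun _ h => h.trans hn')
      (fun _ h => h.trans hm')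

lemma truncTotIso_hom_ι (X : SimplexCategory ⥤ C) :
    (R.truncTotIso hn hm hn hm').hom.app X ≫ truncTotι P n m' X = truncTotι P n m X := by
  refine Pi.hom_ext _ _ fun i => (Category.assoc _ _ _).trans ?_
  exact R.eqzTrans_app_π simplexWeight _ i.2 i.2
    (fun _ => simplexFamiliesIso_hom_fn _ _ _ _ i.2 i.2) X

/-- The comparison map from the truncated totalization to the homotopy limit. -/
def toHolim : truncTot P n m ⟶ holim P :=
  R.eqzTrans simplexWeight (overWeight _) ((truncFamiliesIso hn hm).hom ≫ simplexToOver _ _)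

/-- The homotopy inverse of the comparison map. -/
def ofHolim : holim P ⟶ truncTot P n m :=
  R.eqzTrans (overWeight _) simplexWeight (overToSimplex _ _ ≫ (truncFamiliesIso hn hm).inv)

lemma toHolim_ofHolim : R.toHolim hn hm ≫ R.ofHolim hn hm = 𝟙 _ := by
  refine (R.eqzTrans_comp _ _ _ _ _).trans ?_
  rw [Category.assoc, reassoc_of% simplexToOver_overToSimplex, Iso.hom_inv_id]
  exact R.eqzTrans_id simplexWeight

lemma ofHolim_toHolim : R.ofHolim hn hm ≫ R.toHolim hn hm =
    R.eqzTrans (overWeight _) (overWeight _) (overToSimplex _ _ ≫ simplexToOver _ _) := by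
  refine (R.eqzTrans_comp _ _ _ _ _).trans ?_
  rw [Category.assoc, Iso.inv_hom_id_assoc]

lemma exists_cylinder_ofHolim_toHolim (Z : R.Cylinder) (X : SimplexCategory ⥤ C) :
    ∃ h : Z.obj ((holim P).obj X) ⟶ (holim P).obj X,
      Z.ι false _ ≫ h = (R.ofHolim hn hm).app X ≫ (R.toHolim hn hm).app X ∧
        Z.ι true _ ≫ h = 𝟙 _ := by
  let F := R.eqzHomEquiv (overWeight _) X _ (𝟙 ((holim P).obj X))
  obtain ⟨h, hh⟩ := R.exists_cylinder_of_grpdPath (overWeight _) Z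
    (fun b => if b then 𝟙 _ else (R.ofHolim hn hm ≫ R.toHolim hn hm).app X)
    (lastVertexPathFamily F) (by
      rintro (_ | _)
      · refine (lastVertexPathFamily_false F).trans ?_
        rw [ofHolim_toHolim]
        exact ((R.eqzHomEquiv _ X _).apply_symm_apply _).symm
      · exact lastVertexPathFamily_true F)
  exact ⟨h, hh false, hh true⟩

/-- Maps to the truncated totalization are descent data. -/
def truncTotHomEquiv (X : SimplexCategory ⥤ C) (B : C) :
    (B ⟶ (truncTot P n m).obj X) ≃ Desc (X ⋙ R.hom.obj (op B)) :=
  (R.eqzHomEquiv simplexWeight X B).trans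
    ((familiesIsoDesc (fun _ h => h.trans hn) (fun _ h => h.trans hm)).app _).toEquiv

lemma truncTotHomEquiv_precomp (X : SimplexCategory ⥤ C) {B B' : C} (b : B' ⟶ B)
    (f : B ⟶ (truncTot P n m).obj X) :
    R.truncTotHomEquiv hn hm X B' (b ≫ f) =
      Desc.mapObj (Functor.whiskerLeft X (R.hom.map b.op)) (R.truncTotHomEquiv hn hm X B f) :=
  (congrArg _ (R.eqzHomEquiv_precomp simplexWeight X b f)).trans
    (FunctorFamily.toDesc_map (fun _ h => h.trans hn) (fun _ h => h.trans hm) _ _)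

lemma truncTotHomEquiv_postcomp {X X' : SimplexCategory ⥤ C} (x : X ⟶ X') {B : C}
    (f : B ⟶ (truncTot P n m).obj X) :
    R.truncTotHomEquiv hn hm X' B (f ≫ (truncTot P n m).map x) =
      Desc.mapObj (Functor.whiskerRight x (R.hom.obj (op B)))
        (R.truncTotHomEquiv hn hm X B f) :=
  (congrArg _ (R.eqzHomEquiv_postcomp simplexWeight x f)).trans
    (FunctorFamily.toDesc_map (fun _ h => h.trans hn) (fun _ h => h.trans hm) _ _)

end GroupoidalCotensor

end Comparison

/-! ### Cosimplicial groupoids -/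

section GroupoidCase

open SimplexCategory

lemma functor_functor_ext {D : Type u'} [Category.{v'} D] {K : Type v} [Category.{v} K]
    {A : Type u} [Category.{w} A] {F G : D ⥤ K ⥤ A}
    (hobj : ∀ d k, (F.obj d).obj k = (G.obj d).obj k)
    (hmap : ∀ (d : D) {k k' : K} (f : k ⟶ k'), (F.obj d).map f = eqToHom (hobj d k) ≫
      (G.obj d).map f ≫ eqToHom (hobj d k').symm)
    (happ : ∀ {d d' : D} (g : d ⟶ d') (k : K), (F.map g).app k = eqToHom (hobj d k) ≫
      (G.map g).app k ≫ eqToHom (hobj d' k).symm) : F = G := by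
  refine CategoryTheory.Functor.ext
    (fun d => CategoryTheory.Functor.ext (hobj d) (fun _ _ f => hmap d f)) (fun d d' g => ?_)
  ext k
  rw [happ, NatTrans.comp_app, NatTrans.comp_app, eqToHom_app, eqToHom_app]

/-- Interchange of the variables of a functor of two variables. -/
def grpdFunFlip (B K A : Grpd.{v, v}) :
    (B ⟶ (grpdFun.obj (op K)).obj A) ≃ (K ⟶ (grpdFun.obj (op B)).obj A) where
  toFun F := (Functor.flip F : K ⥤ B ⥤ A)
  invFun F := (Functor.flip F : B ⥤ K ⥤ A)
  left_inv _ := rfl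
  right_inv _ := rfl

/-- The cotensors of groupoids are represented by functor groupoids. -/
def grpdPowCotensor : GroupoidalCotensor grpdPow.{v} where
  hom := grpdFun
  powEquiv K A B := (grpdFunFlip B (fundGrpd.obj K) A).trans (fundGrpdAdj.homEquiv K _)
  powEquiv_precomp {K A B _} b f :=
    fundGrpdAdj.homEquiv_naturality_right (grpdFunFlip B (fundGrpd.obj K) A f)
      ((grpdFun.map b.op).app A)
  powEquiv_postcomp {K A _ B} a f :=
    fundGrpdAdj.homEquiv_naturality_right (grpdFunFlip B (fundGrpd.obj K) A f)
      ((grpdFun.obj (op B)).map a)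
  powEquiv_weight {K _ A B} κ f :=
    fundGrpdAdj.homEquiv_naturality_left κ (grpdFunFlip B (fundGrpd.obj K) A f)

/-- The products of groupoids with the interval. -/
def grpdCylinder : grpdPowCotensor.{v}.Cylinder where
  obj B := Grpd.of (interval.{v} × B)
  ι b B := (Functor.prod' ((Functor.const B).obj (interval.pt b)) (𝟭 B) : B ⥤ interval.{v} × B)
  lift B :=
    { app A := (Functor.uncurry : (interval.{v} ⥤ B ⥤ A) ⥤ interval.{v} × B ⥤ A)
      naturality A A' a := by
        refine functor_functor_ext (D := interval.{v} ⥤ B ⥤ A) (K := interval.{v} × B) (A := A')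
          (fun _ _ => rfl) (fun F k k' f => ?_) (fun _ _ => ?_)
        · change (a : A ⥤ A').map _ ≫ (a : A ⥤ A').map _ =
            𝟙 _ ≫ (a : A ⥤ A').map (_ ≫ _) ≫ 𝟙 _
          rw [Category.id_comp, Category.comp_id, Functor.map_comp]
        · exact ((Category.id_comp _).trans (Category.comp_id _)).symm }
  lift_ι b B A := by
    refine functor_functor_ext (D := interval.{v} ⥤ B ⥤ A) (K := B) (A := A) (fun _ _ => rfl)
      (fun F x y f => ?_) (fun _ _ => ?_)
    · change (F.map (𝟙 _)).app x ≫ (F.obj _).map f = 𝟙 _ ≫ (F.obj _).map f ≫ 𝟙 _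
      simp
    · exact ((Category.id_comp _).trans (Category.comp_id _)).symm

lemma nonempty_iso_of_cylinder {B A : Grpd.{v, v}} {f g : B ⥤ A} (h : grpdCylinder.obj B ⟶ A)
    (hf : grpdCylinder.ι false B ≫ h = f) (hg : grpdCylinder.ι true B ≫ h = g) :
    Nonempty (f ≅ g) := by
  subst hf hg
  let H : interval.{v} ⥤ B ⥤ A := Functor.curry.obj (h : interval.{v} × B ⥤ A)
  have e (b : Bool) : (grpdCylinder.ι b B ⋙ h : B ⥤ A) ≅ H.obj (interval.pt b) :=
    NatIso.ofComponents (fun _ => Iso.refl _) (fun f =>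
      (Category.comp_id _).trans (Category.id_comp _).symm)
  exact ⟨e false ≪≫ H.mapIso (asIso interval.arrow) ≪≫ (e true).symm⟩

variable {X X' : SimplexCategory ⥤ Grpd.{v, v}} {B : Grpd.{v, v}}

lemma grpdFun_eqToHom_app {G : Grpd.{v, v}} {F F' : (grpdFun.obj (op B)).obj G} (h : F = F')
    (b : B) : NatTrans.app (F := (F : B ⥤ G)) (G := (F' : B ⥤ G)) (eqToHom h) b =
      eqToHom (congrArg (fun t : B ⥤ G => t.obj b) h) := by
  subst h
  rfl

namespace Desc

/-- The value at an object of `B` of descent data in functor groupoids `Fun(B, X^n)`. -/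
def eval (x : Desc (X ⋙ grpdFun.obj (op B))) (b : B) : Desc X where
  a := (x.a : B ⥤ X.obj ⦋0⦌).obj b
  α := NatTrans.app x.α b
  unit := (congrArg (fun t => NatTrans.app t b) x.unit).trans
    (grpdFun_eqToHom_app (G := X.obj ⦋0⦌) _ b)
  cocycle := by
    refine Eq.trans ?_ ((congrArg (fun t => NatTrans.app t b) x.cocycle).trans ?_)
    · exact (congrArg (fun t => (X.map (δ 2)).map (NatTrans.app x.α b) ≫ t ≫
        (X.map (δ 0)).map (NatTrans.app x.α b)) (grpdFun_eqToHom_app (G := X.obj ⦋2⦌) _ b)).symm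
    · exact congrArg₂ (fun s t => s ≫ (X.map (δ 1)).map (NatTrans.app x.α b) ≫ t)
        (grpdFun_eqToHom_app (G := X.obj ⦋2⦌) _ b) (grpdFun_eqToHom_app (G := X.obj ⦋2⦌) _ b)

/-- The functor to the descent groupoid given by descent data in functor groupoids. -/
def toFunctor (x : Desc (X ⋙ grpdFun.obj (op B))) : B ⥤ Desc X where
  obj := x.eval
  map f :=
    { β := (x.a : B ⥤ X.obj ⦋0⦌).map f
      comm := NatTrans.naturality x.α f }
  map_id b := Desc.Hom.ext ((x.a : B ⥤ X.obj ⦋0⦌).map_id b)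
  map_comp f g := Desc.Hom.ext ((x.a : B ⥤ X.obj ⦋0⦌).map_comp f g)

/-- The descent data in functor groupoids given by a functor to the descent groupoid. -/
def ofFunctor (T : B ⥤ Desc X) : Desc (X ⋙ grpdFun.obj (op B)) where
  a := ({ obj b := (T.obj b).a
          map f := (T.map f).β
          map_id b := congrArg Desc.Hom.β (T.map_id b)
          map_comp f g := congrArg Desc.Hom.β (T.map_comp f g) } : B ⥤ X.obj ⦋0⦌)
  α := { app b := (T.obj b).α
         naturality b b' f := (T.map f).comm }
  unit := by
    refine NatTrans.ext (funext fun b => Eq.trans (T.obj b).unit (Eq.symm ?_))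
    exact grpdFun_eqToHom_app (G := X.obj ⦋0⦌) _ b
  cocycle := by
    refine NatTrans.ext (funext fun b => ?_)
    refine Eq.trans ?_ ((T.obj b).cocycle.trans ?_)
    · exact congrArg (fun t => (X.map (δ 2)).map (T.obj b).α ≫ t ≫
        (X.map (δ 0)).map (T.obj b).α) (grpdFun_eqToHom_app (G := X.obj ⦋2⦌) _ b)
    · exact (congrArg₂ (fun s t => s ≫ (X.map (δ 1)).map (T.obj b).α ≫ t)
        (grpdFun_eqToHom_app (G := X.obj ⦋2⦌) _ b)
        (grpdFun_eqToHom_app (G := X.obj ⦋2⦌) _ b)).symm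

end Desc

/-- Functors to the descent groupoid are descent data in functor groupoids. -/
def functorDescEquiv (X : SimplexCategory ⥤ Grpd.{v, v}) (B : Grpd.{v, v}) :
    (B ⟶ descFunctor.obj X) ≃ Desc (X ⋙ grpdFun.obj (op B)) where
  toFun T := Desc.ofFunctor T
  invFun x := x.toFunctor
  left_inv _ := rfl
  right_inv _ := rfl

lemma functorDescEquiv_precomp {B' : Grpd.{v, v}} (b : B' ⟶ B) (T : B ⟶ descFunctor.obj X) :
    functorDescEquiv X B' (b ≫ T) =
      Desc.mapObj (Functor.whiskerLeft X (grpdFun.map b.op)) (functorDescEquiv X B T) := by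
  refine Desc.ext' rfl (NatTrans.ext (funext fun c => ?_))
  refine Eq.trans ?_ ((Category.id_comp _).trans (Category.comp_id _)).symm
  exact ((Category.id_comp _).trans (Category.comp_id _)).symm

lemma functorDescEquiv_postcomp (x : X ⟶ X') (T : B ⟶ descFunctor.obj X) :
    functorDescEquiv X' B (T ≫ descFunctor.map x) =
      Desc.mapObj (Functor.whiskerRight x (grpdFun.obj (op B))) (functorDescEquiv X B T) := by
  refine Desc.ext' rfl (NatTrans.ext (funext fun c => ?_))
  refine Eq.trans ?_ ((Category.id_comp _).trans (Category.comp_id _)).symm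
  refine congrArg₂ (fun s t => s ≫ (x.app ⦋1⦌).map (T.obj c).α ≫ t) (Eq.symm ?_) (Eq.symm ?_)
  · exact grpdFun_eqToHom_app (G := X'.obj ⦋1⦌) _ c
  · exact grpdFun_eqToHom_app (G := X'.obj ⦋1⦌) _ c

variable {n m : ℕ} (hn : 2 ≤ n) (hm : 1 ≤ m)

/-- Maps of groupoids to the truncated totalization are descent data in functor groupoids. -/
def truncTotGrpdEquiv (X : SimplexCategory ⥤ Grpd.{v, v}) (B : Grpd.{v, v}) :
    (B ⟶ (truncTot grpdPow n m).obj X) ≃ Desc (X ⋙ grpdFun.obj (op B)) :=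
  grpdPowCotensor.truncTotHomEquiv hn hm X B

/-- The descent groupoid and the truncated totalization have the same generalized elements. -/
def descHomEquiv (X : SimplexCategory ⥤ Grpd.{v, v}) (B : Grpd.{v, v}) :
    (B ⟶ descFunctor.obj X) ≃ (B ⟶ (truncTot grpdPow n m).obj X) :=
  (functorDescEquiv X B).trans (truncTotGrpdEquiv hn hm X B).symm

lemma descHomEquiv_precomp {B' : Grpd.{v, v}} (b : B' ⟶ B) (T : B ⟶ descFunctor.obj X) :
    descHomEquiv hn hm X B' (b ≫ T) = b ≫ descHomEquiv hn hm X B T := by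
  dsimp only [descHomEquiv, Equiv.trans_apply]
  rw [Equiv.symm_apply_eq, functorDescEquiv_precomp]
  refine Eq.trans ?_ (grpdPowCotensor.truncTotHomEquiv_precomp hn hm X b _).symm
  exact congrArg _ ((truncTotGrpdEquiv hn hm X B).apply_symm_apply _).symm

lemma descHomEquiv_postcomp (x : X ⟶ X') (T : B ⟶ descFunctor.obj X) :
    descHomEquiv hn hm X' B (T ≫ descFunctor.map x) =
      descHomEquiv hn hm X B T ≫ (truncTot grpdPow n m).map x := by
  dsimp only [descHomEquiv, Equiv.trans_apply]
  rw [Equiv.symm_apply_eq, functorDescEquiv_postcomp]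
  refine Eq.trans ?_ (grpdPowCotensor.truncTotHomEquiv_postcomp hn hm x _).symm
  exact congrArg _ ((truncTotGrpdEquiv hn hm X B).apply_symm_apply _).symm

/-- The descent groupoid is the truncated totalization. -/
def descIso : descFunctor.{v} ≅ truncTot grpdPow.{v} n m :=
  (Yoneda.fullyFaithful.whiskeringRight _).preimageIso <| NatIso.ofComponents
    (fun X => NatIso.ofComponents (fun B => (descHomEquiv hn hm X B.unop).toIso) fun b => by
      ext T
      exact descHomEquiv_precomp hn hm b.unop T)
    fun x => by
      ext B T
      exact descHomEquiv_postcomp hn hm x T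

lemma isEquivalence_toHolim (X : SimplexCategory ⥤ Grpd.{v, v}) :
    Functor.IsEquivalence ((grpdPowCotensor.toHolim hn hm).app X) := by
  obtain ⟨h, h_false, h_true⟩ :=
    grpdPowCotensor.exists_cylinder_ofHolim_toHolim hn hm grpdCylinder X
  obtain ⟨e⟩ := nonempty_iso_of_cylinder (g := 𝟭 _) h h_false h_true
  exact (CategoryTheory.Equivalence.mk ((grpdPowCotensor.toHolim hn hm).app X)
    ((grpdPowCotensor.ofHolim hn hm).app X)
    (eqToIso (congr_app (grpdPowCotensor.toHolim_ofHolim hn hm) X).symm) e).isEquivalence_functor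

end GroupoidCase

/-! ### Enriched homs, cotensors and tensors -/

section Whisker

variable {V : Type u'} [Category.{v'} V] [CartesianMonoidalCategory V]
  {D : Type u} [Category.{v} D] [EnrichedOrdinaryCategory V D]

lemma eHomWhiskerRight_eq_lift {A B : D} (f : A ⟶ B) (Z : D) : eHomWhiskerRight V f Z =
    lift (toUnit _ ≫ eHomEquiv V f) (𝟙 _) ≫ eComp V A B Z := by
  rw [eHomWhiskerRight, ← Category.assoc]
  congr 1
  ext <;> simp

lemma eHomWhiskerLeft_eq_lift (Z : D) {A B : D} (f : A ⟶ B) : eHomWhiskerLeft V Z f =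
    lift (𝟙 _) (toUnit _ ≫ eHomEquiv V f) ≫ eComp V Z A B := by
  rw [eHomWhiskerLeft, ← Category.assoc]
  congr 1
  ext <;> simp

end Whisker

section EHomEquiv

variable {V : Type u'} [Category.{v'} V] [MonoidalCategory V]
  {D : Type u} [Category.{v} D] [EnrichedOrdinaryCategory V D]

lemma eHomEquiv_eHomWhiskerLeft {A B Z : D} (f : A ⟶ B) (g : B ⟶ Z) :
    eHomEquiv V f ≫ eHomWhiskerLeft V A g = eHomEquiv V (f ≫ g) := by
  rw [eHomEquiv_comp, eHomWhiskerLeft, rightUnitor_inv_naturality_assoc, unitors_inv_equal,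
    MonoidalCategory.tensorHom_def, Category.assoc]

lemma eHomEquiv_eHomWhiskerRight {A B Z : D} (f : A ⟶ B) (g : B ⟶ Z) :
    eHomEquiv V g ≫ eHomWhiskerRight V f Z = eHomEquiv V (f ≫ g) := by
  rw [eHomEquiv_comp, eHomWhiskerRight, leftUnitor_inv_naturality_assoc,
    MonoidalCategory.tensorHom_def', Category.assoc]

variable [TensoredCotensored V D]

/-- Maps `B ⟶ A^K` are maps `K ⟶ Hom(B, A)`. -/
def powHomEquiv (K : V) (A B : D) : (B ⟶ pow V K A) ≃ (K ⟶ (B ⟶[V] A)) where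
  toFun f := powEv V K A ≫ eHomWhiskerRight V f A
  invFun := powLift
  left_inv _ := pow_hom_ext (powEv_powLift _)
  right_inv := powEv_powLift

lemma powHomEquiv_precomp {K : V} {A B B' : D} (b : B' ⟶ B) (f : B ⟶ pow V K A) :
    powHomEquiv K A B' (b ≫ f) = powHomEquiv K A B f ≫ eHomWhiskerRight V b A := by
  dsimp only [powHomEquiv, Equiv.coe_fn_mk]
  rw [eHomWhiskerRight_comp, Category.assoc]

lemma powHomEquiv_powMap {K K' : V} {A A' B : D} (κ : K' ⟶ K) (a : A ⟶ A') (f : B ⟶ pow V K A) :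
    powHomEquiv K' A' B (f ≫ powMap κ a) =
      κ ≫ powHomEquiv K A B f ≫ eHomWhiskerLeft V B a := by
  dsimp only [powHomEquiv, Equiv.coe_fn_mk]
  rw [eHomWhiskerRight_comp, reassoc_of% powEv_powMap, eHom_whisker_exchange, Category.assoc]

lemma ten_bijective (K : V) (A B : D) (L : V) : Function.Bijective
    (fun f : L ⟶ (ten V K A ⟶[V] B) =>
      ((tenCoev V K A ⊗ₘ f) ≫ eComp V A (ten V K A) B : K ⊗ L ⟶ (A ⟶[V] B))) :=
  (TensoredCotensored.tensor K A : Tensor V K A).bijective B L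

/-- Maps `L ⟶ Hom(A ⊗ K, B)` are maps `K ⊗ L ⟶ Hom(A, B)`. -/
def tenEHomEquiv (K : V) (A B : D) (L : V) :
    (L ⟶ (ten V K A ⟶[V] B)) ≃ (K ⊗ L ⟶ (A ⟶[V] B)) :=
  Equiv.ofBijective _ (ten_bijective K A B L)

lemma tenEHomEquiv_apply {K L : V} {A B : D} (f : L ⟶ (ten V K A ⟶[V] B)) :
    tenEHomEquiv K A B L f = K ◁ f ≫ tenCoev V K A ▷ _ ≫ eComp V A (ten V K A) B :=
  (congrArg (· ≫ _) (MonoidalCategory.tensorHom_def' _ _)).trans (Category.assoc _ _ _)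

/-- Maps `A ⊗ K ⟶ B` are maps `K ⟶ Hom(A, B)`. -/
def tenHomEquiv (K : V) (A B : D) : (ten V K A ⟶ B) ≃ (K ⟶ (A ⟶[V] B)) :=
  ((eHomEquiv V).trans (tenEHomEquiv K A B (𝟙_ V))).trans (ρ_ K).homFromEquiv

lemma tenHomEquiv_apply {K : V} {A B : D} (f : ten V K A ⟶ B) :
    tenHomEquiv K A B f = tenCoev V K A ≫ eHomWhiskerLeft V A f := by
  change (ρ_ K).inv ≫ (tenCoev V K A ⊗ₘ eHomEquiv V f) ≫ eComp V A (ten V K A) B = _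
  rw [eHomWhiskerLeft, rightUnitor_inv_naturality_assoc, MonoidalCategory.tensorHom_def,
    Category.assoc]

lemma tenHomEquiv_postcomp {K : V} {A B B' : D} (f : ten V K A ⟶ B) (g : B ⟶ B') :
    tenHomEquiv K A B' (f ≫ g) = tenHomEquiv K A B f ≫ eHomWhiskerLeft V A g := by
  rw [tenHomEquiv_apply, tenHomEquiv_apply, eHomWhiskerLeft_comp, Category.assoc]

/-- The map `A ⟶ A ⊗ K` given by a point of `K`. -/
def tenPt {K : V} (x : 𝟙_ V ⟶ K) (A : D) : A ⟶ ten V K A :=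
  (eHomEquiv V).symm (x ≫ tenCoev V K A)

lemma eHomEquiv_tenPt_comp {K : V} (x : 𝟙_ V ⟶ K) {A B : D} (f : ten V K A ⟶ B) :
    eHomEquiv V (tenPt x A ≫ f) = x ≫ tenHomEquiv K A B f := by
  rw [← eHomEquiv_eHomWhiskerLeft, tenPt, Equiv.apply_symm_apply, tenHomEquiv_apply,
    Category.assoc]

end EHomEquiv

/-! ### Tensors with the interval groupoid -/

section Interval

/-- The evaluation functor `interval × Fun(interval, G) ⥤ G`. -/
def pathEval (G : Grpd.{v, v}) : interval ⊗ grpdPath.obj G ⟶ G :=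
  (evaluationUncurried interval.{v} G : interval.{v} × (interval.{v} ⥤ G) ⥤ G)

lemma pathEval_naturality {G G' : Grpd.{v, v}} (g : G ⟶ G') :
    interval ◁ grpdPath.map g ≫ pathEval G' = pathEval G ≫ g := by
  refine CategoryTheory.Functor.ext (fun _ => rfl) (fun x y f => ?_)
  change _ = 𝟙 _ ≫ (g : G ⥤ G').map _ ≫ 𝟙 _
  rw [Category.id_comp, Category.comp_id]
  exact ((g : G ⥤ G').map_comp _ _).symm

/-- The inclusion of an endpoint of the interval. -/
def intervalPt (b : Bool) : 𝟙_ Grpd.{v, v} ⟶ interval :=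
  ((Functor.const (Discrete PUnit)).obj (interval.pt b) : Discrete PUnit.{v + 1} ⥤ interval.{v})

lemma intervalPt_pathEval (b : Bool) (G : Grpd.{v, v}) :
    (λ_ _).inv ≫ intervalPt b ▷ grpdPath.obj G ≫ pathEval G = (grpdPathEnd b).app G := by
  refine CategoryTheory.Functor.ext (fun _ => rfl) (fun x y f => ?_)
  change (x : interval ⥤ G).map (𝟙 _) ≫ f.app _ = 𝟙 _ ≫ f.app _ ≫ 𝟙 _
  rw [Category.id_comp, Category.comp_id]
  exact (congrArg (· ≫ f.app (interval.pt b)) ((x : interval ⥤ G).map_id (interval.pt b))).trans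
    (Category.id_comp _)

variable {C : Type u} [Category.{v} C] [EnrichedOrdinaryCategory Grpd.{v, v} C]
  [TensoredCotensored Grpd.{v, v} C]

/-- The map `Fun(interval, Hom(B, A)) ⟶ Hom(B ⊗ interval, A)`. -/
def tenPathLift (B A : C) : grpdPath.obj (B ⟶[Grpd.{v, v}] A) ⟶
    (ten Grpd.{v, v} interval B ⟶[Grpd.{v, v}] A) :=
  (tenEHomEquiv interval B A _).symm (pathEval _)

lemma tenPathLift_eComp (B A : C) : interval ◁ tenPathLift B A ≫
    tenCoev Grpd.{v, v} interval B ▷ _ ≫ eComp Grpd.{v, v} B _ A = pathEval _ :=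
  (tenEHomEquiv_apply _).symm.trans ((tenEHomEquiv interval B A _).apply_symm_apply (pathEval _))

lemma tenPathLift_naturality (B : C) {A A' : C} (a : A ⟶ A') :
    grpdPath.map (eHomWhiskerLeft Grpd.{v, v} B a) ≫ tenPathLift B A' =
      tenPathLift B A ≫ eHomWhiskerLeft Grpd.{v, v} _ a := by
  apply (tenEHomEquiv interval B A' _).injective
  rw [tenEHomEquiv_apply, tenEHomEquiv_apply, MonoidalCategory.whiskerLeft_comp, Category.assoc,
    tenPathLift_eComp, pathEval_naturality, ← tenPathLift_eComp, MonoidalCategory.whiskerLeft_comp]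
  simp only [Category.assoc, eComp_eHomWhiskerLeft, whisker_exchange_assoc]

lemma tenPathLift_comp_eHomWhiskerRight_tenPt (b : Bool) (B A : C) :
    tenPathLift B A ≫ eHomWhiskerRight Grpd.{v, v} (tenPt (intervalPt b) B) A =
      (grpdPathEnd b).app _ := by
  rw [eHomWhiskerRight, tenPt, Equiv.apply_symm_apply, leftUnitor_inv_naturality_assoc,
    ← intervalPt_pathEval, ← tenPathLift_eComp, comp_whiskerRight, Category.assoc,
    whisker_exchange_assoc]

end Interval

/-! ### Simplicial categories that derive from an enrichment over groupoids -/

lemma map_lift_prodComparison {D : Type u} [Category.{v} D] [CartesianMonoidalCategory D]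
    {E : Type u'} [Category.{v'} E] [CartesianMonoidalCategory E] (F : D ⥤ E) {S A B : D}
    (f : S ⟶ A) (g : S ⟶ B) :
    F.map (lift f g) ≫ CartesianMonoidalCategory.prodComparison F A B =
      lift (F.map f) (F.map g) := by
  ext <;> simp [← Functor.map_comp]

namespace DerivesFromGrpd

open SimplicialCategory

variable {C : Type u} [Category.{v} C] [SimplicialCategory C] [TensoredCotensored SSet.{v} C]
  [EnrichedOrdinaryCategory Grpd.{v, v} C] [TensoredCotensored Grpd.{v, v} C]
  (h : DerivesFromGrpd C)

lemma map_lift_eComp_homIso_inv {A B D : C} {S : Grpd.{v, v}} (f : S ⟶ (A ⟶[Grpd.{v, v}] B))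
    (g : S ⟶ (B ⟶[Grpd.{v, v}] D)) :
    grpdNerve.map (lift f g ≫ eComp Grpd.{v, v} A B D) ≫ (h.homIso A D).inv =
      lift (grpdNerve.map f ≫ (h.homIso A B).inv) (grpdNerve.map g ≫ (h.homIso B D).inv) ≫
        eComp SSet.{v} A B D := by
  rw [Functor.map_comp, Category.assoc, h.eComp_comp, reassoc_of% map_lift_prodComparison,
    lift_map_assoc]

lemma eHomWhiskerRight_eq {A B : C} (f : A ⟶ B) (Z : C) :
    eHomWhiskerRight SSet.{v} f Z = (h.homIso B Z).hom ≫
      grpdNerve.map (eHomWhiskerRight Grpd.{v, v} f Z) ≫ (h.homIso A Z).inv := by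
  rw [← Iso.inv_comp_eq, eHomWhiskerRight_eq_lift, eHomWhiskerRight_eq_lift,
    map_lift_eComp_homIso_inv, comp_lift_assoc, Functor.map_comp, Category.assoc, h.homEquiv_comp,
    CategoryTheory.Functor.map_id, Category.id_comp, Category.comp_id, ← Category.assoc,
    ← Category.assoc]
  congr 3

lemma eHomWhiskerLeft_eq (Z : C) {A B : C} (f : A ⟶ B) :
    eHomWhiskerLeft SSet.{v} Z f = (h.homIso Z A).hom ≫
      grpdNerve.map (eHomWhiskerLeft Grpd.{v, v} Z f) ≫ (h.homIso Z B).inv := by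
  rw [← Iso.inv_comp_eq, eHomWhiskerLeft_eq_lift, eHomWhiskerLeft_eq_lift,
    map_lift_eComp_homIso_inv, comp_lift_assoc, Functor.map_comp, Category.assoc, h.homEquiv_comp,
    CategoryTheory.Functor.map_id, Category.id_comp, Category.comp_id, ← Category.assoc,
    ← Category.assoc]
  congr 3

/-- Maps `B ⟶ A^K` are maps from `K` to the nerve of the hom groupoid `Hom(B, A)`. -/
def powNerveEquiv (K : SSet.{v}) (A B : C) :
    (B ⟶ pow SSet.{v} K A) ≃ (K ⟶ grpdNerve.obj (B ⟶[Grpd.{v, v}] A)) :=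
  (powHomEquiv K A B).trans (Iso.homToEquiv (h.homIso B A))

lemma powNerveEquiv_apply {K : SSet.{v}} {A B : C} (f : B ⟶ pow SSet.{v} K A) :
    h.powNerveEquiv K A B f = powHomEquiv K A B f ≫ (h.homIso B A).hom :=
  rfl

lemma powNerveEquiv_precomp {K : SSet.{v}} {A B B' : C} (b : B' ⟶ B) (f : B ⟶ pow SSet.{v} K A) :
    h.powNerveEquiv K A B' (b ≫ f) =
      h.powNerveEquiv K A B f ≫ grpdNerve.map (eHomWhiskerRight Grpd.{v, v} b A) := by
  simp only [powNerveEquiv_apply, powHomEquiv_precomp, h.eHomWhiskerRight_eq, Category.assoc,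
    Iso.inv_hom_id, Category.comp_id]

lemma powNerveEquiv_powMap {K K' : SSet.{v}} {A A' B : C} (κ : K' ⟶ K) (a : A ⟶ A')
    (f : B ⟶ pow SSet.{v} K A) :
    h.powNerveEquiv K' A' B (f ≫ powMap κ a) =
      κ ≫ h.powNerveEquiv K A B f ≫ grpdNerve.map (eHomWhiskerLeft Grpd.{v, v} B a) := by
  simp only [powNerveEquiv_apply, powHomEquiv_powMap, h.eHomWhiskerLeft_eq, Category.assoc,
    Iso.inv_hom_id, Category.comp_id]

/-- The cotensors by simplicial sets are represented by the hom groupoids. -/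
def powCotensor : GroupoidalCotensor (powFunctor SSet.{v} C) where
  hom := eHomFunctor Grpd.{v, v} C
  powEquiv := h.powNerveEquiv
  powEquiv_precomp := h.powNerveEquiv_precomp
  powEquiv_postcomp {K _ _ _} a f :=
    (h.powNerveEquiv_powMap (𝟙 K) a f).trans (Category.id_comp _)
  powEquiv_weight {_ _ A B} κ f := by
    refine (h.powNerveEquiv_powMap κ (𝟙 A) f).trans ?_
    rw [eHomWhiskerLeft_id, CategoryTheory.Functor.map_id, Category.comp_id]
    rfl

/-- The tensors with the interval groupoid. -/
def cylinder : h.powCotensor.Cylinder where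
  obj B := ten Grpd.{v, v} interval B
  ι b B := tenPt (intervalPt b) B
  lift B :=
    { app A := tenPathLift B A
      naturality _ _ a := tenPathLift_naturality B a }
  lift_ι b B A := tenPathLift_comp_eHomWhiskerRight_tenPt b B A

end DerivesFromGrpd

/-! ### Simplicial homotopies -/

section Vertices

/-- The vertex of `Δ[1]` that is the image of the `i`-th coface. -/
def simplexPt (i : Fin 2) : 𝟙_ SSet.{v} ⟶ Δ[1] :=
  SSet.stdSimplex.isTerminalObj₀.from _ ≫ SSet.stdSimplex.δ i

lemma toUnit_simplexPt (i : Fin 2) : toUnit Δ[0] ≫ simplexPt.{v} i = SSet.stdSimplex.δ i := by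
  rw [simplexPt, ← Category.assoc, SSet.stdSimplex.isTerminalObj₀.hom_ext
    (toUnit Δ[0] ≫ SSet.stdSimplex.isTerminalObj₀.from _) (𝟙 _), Category.id_comp]

lemma unitHomEquiv_simplexPt_comp (i : Fin 2) {S : SSet.{v}} (e : S _⦋1⦌) :
    S.unitHomEquiv (simplexPt i ≫ SSet.yonedaEquiv.symm e) = S.δ i e := by
  change SSet.yonedaEquiv (toUnit Δ[0] ≫ simplexPt i ≫ SSet.yonedaEquiv.symm e) = _
  rw [← Category.assoc, toUnit_simplexPt]
  change SSet.yonedaEquiv (SSet.stdSimplex.map (SimplexCategory.δ i) ≫ _) = _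
  rw [SSet.yonedaEquiv_symm_naturality_left, Equiv.apply_symm_apply]
  rfl

lemma toUnit_simplexPt_eq_horn_ι {i j : Fin 2} (hij : j ≠ i) :
    toUnit _ ≫ simplexPt.{v} j = (Λ[1, i] : (Δ[1] : SSet.{v}).Subcomplex).ι := by
  refine SSet.horn.hom_ext' fun k hk => ?_
  obtain rfl : k = j := by omega
  rw [SSet.horn.ι_ι, ← toUnit_simplexPt, ← Category.assoc]
  rfl

lemma exists_comp_horn_ι_eq_simplexPt {i j : Fin 2} (hij : j ≠ i) :
    ∃ x, x ≫ (Λ[1, i] : (Δ[1] : SSet.{v}).Subcomplex).ι = simplexPt j :=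
  ⟨SSet.stdSimplex.isTerminalObj₀.from _ ≫ SSet.horn.ι i j hij, by
    rw [Category.assoc, SSet.horn.ι_ι, simplexPt]⟩

lemma hasLiftingProperty_simplexPt {S T : SSet.{v}} {φ : S ⟶ T}
    (hφ : SSet.modelCategoryQuillen.J.rlp φ) (j : Fin 2) :
    HasLiftingProperty (simplexPt j) φ := by
  have hj : j ≠ j.rev := by fin_cases j <;> decide
  have : HasLiftingProperty (Λ[1, j.rev] : (Δ[1] : SSet.{v}).Subcomplex).ι φ :=
    hφ _ (SSet.modelCategoryQuillen.horn_ι_mem_J 1 j.rev)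
  obtain ⟨x, hx⟩ := exists_comp_horn_ι_eq_simplexPt hj
  let e : 𝟙_ SSet.{v} ≅ Λ[1, j.rev] :=
    { hom := x
      inv := toUnit _
      hom_inv_id := toUnit_unique _ _
      inv_hom_id := by
        rw [← cancel_mono (Λ[1, j.rev] : (Δ[1] : SSet.{v}).Subcomplex).ι, Category.assoc, hx,
          toUnit_simplexPt_eq_horn_ι hj, Category.id_comp] }
  have arrowIso : Arrow.mk (Λ[1, j.rev] : (Δ[1] : SSet.{v}).Subcomplex).ι ≅
      Arrow.mk (simplexPt j) :=
    Arrow.isoMk e.symm (Iso.refl _)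
      ((toUnit_simplexPt_eq_horn_ι hj).trans (Category.comp_id _).symm)
  exact HasLiftingProperty.of_arrow_iso_left arrowIso φ

end Vertices

section SimplicialHomotopies

open SimplicialCategory

variable {C : Type u} [Category.{v} C] [SimplicialCategory C]

lemma homEquiv'_comp {A B Z : C} (f : A ⟶ B) (g : B ⟶ Z) :
    homEquiv' A Z (f ≫ g) = (eHomWhiskerRight SSet.{v} f Z).app _ (homEquiv' B Z g) := by
  change (SSet.unitHomEquiv _) (eHomEquiv SSet.{v} (f ≫ g)) = _
  rw [← eHomEquiv_eHomWhiskerRight]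
  rfl

lemma SimplicialHomotopic.refl {A B : C} (f : A ⟶ B) : SimplicialHomotopic f f := by
  refine ⟨(sHom A B).σ 0 (homEquiv' A B f), ?_, ?_⟩
  · exact ConcreteCategory.congr_hom ((sHom A B).δ_comp_σ_succ (i := 0)) _
  · exact ConcreteCategory.congr_hom ((sHom A B).δ_comp_σ_self (i := 0)) _

lemma SimplicialHomotopic.precomp {A B Z : C} (p : A ⟶ B) {f g : B ⟶ Z}
    (h : SimplicialHomotopic f g) : SimplicialHomotopic (p ≫ f) (p ≫ g) := by
  obtain ⟨e, h₁, h₀⟩ := h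
  have whisker_δ (i : Fin 2) := ConcreteCategory.congr_hom
    (SimplicialObject.δ_naturality (eHomWhiskerRight SSet.{v} p Z) i) e
  refine ⟨(eHomWhiskerRight SSet.{v} p Z).app _ e, ?_, ?_⟩
  · rw [homEquiv'_comp, ← h₁]
    exact (whisker_δ 1).symm
  · rw [homEquiv'_comp, ← h₀]
    exact (whisker_δ 0).symm

variable [TensoredCotensored SSet.{v} C]

lemma homEquiv'_tenPt_comp {A B : C} (i : Fin 2) (e : (sHom A B) _⦋1⦌) :
    homEquiv' A B (tenPt (simplexPt i) A ≫
      (tenHomEquiv Δ[1] A B).symm (SSet.yonedaEquiv.symm e)) = (sHom A B).δ i e := by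
  change SSet.unitHomEquiv _ (eHomEquiv SSet.{v} _) = _
  rw [eHomEquiv_tenPt_comp, Equiv.apply_symm_apply, unitHomEquiv_simplexPt_comp]

lemma SimplicialHomotopic.exists_ten {A B : C} {f g : A ⟶ B} (h : SimplicialHomotopic f g) :
    ∃ K : ten SSet.{v} Δ[1] A ⟶ B,
      tenPt (simplexPt 1) A ≫ K = f ∧ tenPt (simplexPt 0) A ≫ K = g := by
  obtain ⟨e, h₁, h₀⟩ := h
  exact ⟨(tenHomEquiv Δ[1] A B).symm (SSet.yonedaEquiv.symm e),
    (homEquiv' A B).injective ((homEquiv'_tenPt_comp 1 e).trans h₁),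
    (homEquiv' A B).injective ((homEquiv'_tenPt_comp 0 e).trans h₀)⟩

lemma subsingleton_hom_sHom_initial [HasInitial C] (K : SSet.{v}) (X : C) :
    Subsingleton (K ⟶ sHom (⊥_ C) X) :=
  (powHomEquiv K X (⊥_ C)).symm.subsingleton

namespace DerivesFromGrpd

variable [EnrichedOrdinaryCategory Grpd.{v, v} C] [TensoredCotensored Grpd.{v, v} C]

/-- The path in a simplicial hom that corresponds to a map out of the groupoid cylinder. -/
def cylinderPath (h : DerivesFromGrpd C) {B Z : C} (H : ten Grpd.{v, v} interval B ⟶ Z) :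
    grpdNerve.obj interval ⟶ sHom B Z :=
  grpdNerve.map (tenHomEquiv interval B Z H) ≫ (h.homIso B Z).inv

lemma homEquiv'_tenPt_intervalPt_comp (h : DerivesFromGrpd C) {B Z : C}
    (H : ten Grpd.{v, v} interval B ⟶ Z) (b : Bool) :
    homEquiv' B Z (tenPt (intervalPt b) B ≫ H) =
      (h.cylinderPath H).app (op ⦋0⦌) (ComposableArrows.mk₀ (interval.pt b)) := by
  let pt : (grpdNerve.obj (𝟙_ Grpd.{v, v})) _⦋0⦌ :=
    ComposableArrows.mk₀ (⟨⟨⟩⟩ : Discrete PUnit.{v + 1})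
  have hpt : (grpdNerve.map (intervalPt.{v} b)).app (op ⦋0⦌) pt =
      ComposableArrows.mk₀ (interval.pt b) :=
    ComposableArrows.ext₀ rfl
  have component := ConcreteCategory.congr_hom (NatTrans.congr_app
    (h.homEquiv_comp (tenPt (intervalPt b) B ≫ H)) (op ⦋0⦌)) pt
  rw [eHomEquiv_tenPt_comp] at component
  exact component.symm.trans (congrArg ((h.cylinderPath H).app (op ⦋0⦌)) hpt)

lemma simplicialHomotopic_tenPt_comp (h : DerivesFromGrpd C) {B Z : C}
    (H : ten Grpd.{v, v} interval B ⟶ Z) :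
    SimplicialHomotopic (tenPt (intervalPt false) B ≫ H) (tenPt (intervalPt true) B ≫ H) := by
  let e : (grpdNerve.obj interval.{v}) _⦋1⦌ := ComposableArrows.mk₁ interval.arrow.{v}
  have path_δ (i : Fin 2) := ConcreteCategory.congr_hom
    (SimplicialObject.δ_naturality (h.cylinderPath H) i) e
  let atVertices := (h.cylinderPath H).app (op ⦋0⦌)
  refine ⟨(h.cylinderPath H).app _ e, ?_, ?_⟩
  · rw [homEquiv'_tenPt_intervalPt_comp]
    exact (path_δ 1).symm.trans (congrArg atVertices (ComposableArrows.ext₀ rfl))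
  · rw [homEquiv'_tenPt_intervalPt_comp]
    exact (path_δ 0).symm.trans (congrArg atVertices (ComposableArrows.ext₀ rfl))

variable [HasProducts.{0} C] [HasEqualizers C] (h : DerivesFromGrpd C) {n m : ℕ} (hn : 2 ≤ n)
  (hm : 1 ≤ m) (X : SimplexCategory ⥤ C)

lemma simplicialHomotopic_ofHolim_toHolim :
    SimplicialHomotopic ((h.powCotensor.ofHolim hn hm).app X ≫
      (h.powCotensor.toHolim hn hm).app X) (𝟙 _) := by
  obtain ⟨H, H_false, H_true⟩ :=
    h.powCotensor.exists_cylinder_ofHolim_toHolim hn hm h.cylinder X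
  rw [← H_false, ← H_true]
  exact h.simplicialHomotopic_tenPt_comp H

lemma isSimplicialHomotopyEquiv_toHolim :
    IsSimplicialHomotopyEquiv ((h.powCotensor.toHolim hn hm).app X) := by
  refine ⟨(h.powCotensor.ofHolim hn hm).app X, ?_, h.simplicialHomotopic_ofHolim_toHolim hn hm X⟩
  rw [← NatTrans.comp_app, h.powCotensor.toHolim_ofHolim hn hm]
  exact .refl _

end DerivesFromGrpd

end SimplicialHomotopies

/-! ### Homotopic maps in a simplicial model category -/

section ModelCategory

open SimplicialCategory

variable {C : Type u} [Category.{v} C] [ModelCategory C]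

lemma exists_isCofibrant_weakEquivalence (A : C) :
    ∃ (B : C) (p : B ⟶ A), IsCofibrant B ∧ WeakEquivalence p := by
  let F := MorphismProperty.factorizationData (cofibrations C) (trivialFibrations C) (initial.to A)
  have : Cofibration F.i := ⟨F.hi⟩
  refine ⟨F.Z, F.p, ?_, ⟨F.hp.2⟩⟩
  rwa [isCofibrant_iff, Subsingleton.elim (initial.to F.Z) F.i]

variable [SimplicialCategory C] [TensoredCotensored SSet.{v} C] [IsSimplicialModelCategory C]

lemma hasLiftingProperty_tenPt (A : C) [IsCofibrant A] (j : Fin 2) {X Y : C} (q : X ⟶ Y)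
    [Fibration q] : HasLiftingProperty (tenPt (simplexPt.{v} j) A) q := by
  refine ⟨fun {x y} sq => ?_⟩
  have hX (K : SSet.{v}) := subsingleton_hom_sHom_initial K X
  have hY (K : SSet.{v}) := subsingleton_hom_sHom_initial K Y
  have := hasLiftingProperty_simplexPt
    (IsSimplicialModelCategory.fibration (initial.to A) q) j
  let path : Δ[1] ⟶ pullback (eHomWhiskerLeft SSet.{v} (⊥_ C) q)
      (eHomWhiskerRight SSet.{v} (initial.to A) Y) :=
    pullback.lift (powHomEquiv _ _ _ (initial.to (pow SSet.{v} Δ[1] X))) (tenHomEquiv _ _ _ y)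
      (Subsingleton.elim _ _)
  have pathSq : CommSq (eHomEquiv SSet.{v} x) (simplexPt j) (pullbackHom (initial.to A) q) path :=
    ⟨pullback.hom_ext (Subsingleton.elim _ _) (by
      rw [Category.assoc, Category.assoc, pullback.lift_snd, pullbackHom, pullback.lift_snd,
        ← eHomEquiv_tenPt_comp, ← sq.w, eHomEquiv_eHomWhiskerLeft])⟩
  have lift_whisker : pathSq.lift ≫ eHomWhiskerLeft SSet.{v} A q = tenHomEquiv Δ[1] A Y y := by
    have := congrArg (· ≫ pullback.snd _ _) pathSq.fac_right
    simpa only [pullbackHom, Category.assoc, path, pullback.lift_snd] using this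
  refine ⟨⟨(tenHomEquiv Δ[1] A X).symm pathSq.lift, ?_, ?_⟩⟩
  · apply (eHomEquiv SSet.{v}).injective
    rw [eHomEquiv_tenPt_comp, Equiv.apply_symm_apply, pathSq.fac_left]
  · apply (tenHomEquiv Δ[1] A Y).injective
    rw [tenHomEquiv_postcomp, Equiv.apply_symm_apply, lift_whisker]

lemma weakEquivalence_tenPt (A : C) [IsCofibrant A] (j : Fin 2) :
    WeakEquivalence (tenPt (simplexPt.{v} j) A) := by
  suffices trivialCofibrations C (tenPt (simplexPt.{v} j) A) from
    ((mem_trivialCofibrations_iff _).1 this).2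
  rw [← fibrations_llp]
  intro X Y q hq
  have : Fibration q := ⟨hq⟩
  exact hasLiftingProperty_tenPt A j q

lemma weakEquivalence_of_simplicialHomotopic_id {A : C} {f : A ⟶ A}
    (h : SimplicialHomotopic f (𝟙 A)) : WeakEquivalence f := by
  obtain ⟨B, p, _, _⟩ := exists_isCofibrant_weakEquivalence A
  obtain ⟨K, hK₁, hK₀⟩ := (h.precomp p).exists_ten
  rw [Category.comp_id] at hK₀
  have := weakEquivalence_tenPt B 0
  have := weakEquivalence_tenPt B 1
  have : WeakEquivalence K := weakEquivalence_of_precomp_of_fac hK₀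
  have : WeakEquivalence (p ≫ f) := by
    rw [← hK₁]
    infer_instance
  exact weakEquivalence_of_precomp p f

lemma weakEquivalence_of_retraction {A B : C} {f : A ⟶ B} {g : B ⟶ A} (hfg : f ≫ g = 𝟙 A)
    (h : SimplicialHomotopic (g ≫ f) (𝟙 B)) : WeakEquivalence f := by
  have hgf := weakEquivalence_of_simplicialHomotopic_id h
  have r : RetractArrow f (g ≫ f) :=
    { i := Arrow.homMk f (𝟙 B) (by simp [reassoc_of% hfg])
      r := Arrow.homMk g (𝟙 B) (by simp)
      retract := by ext <;> simp [hfg] }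
  exact ⟨(weakEquivalences C).of_retract r hgf.mem⟩

lemma DerivesFromGrpd.weakEquivalence_toHolim [EnrichedOrdinaryCategory Grpd.{v, v} C]
    [TensoredCotensored Grpd.{v, v} C] [HasProducts.{0} C] (h : DerivesFromGrpd C) {n m : ℕ}
    (hn : 2 ≤ n) (hm : 1 ≤ m) (X : SimplexCategory ⥤ C) :
    WeakEquivalence ((h.powCotensor.toHolim hn hm).app X) :=
  weakEquivalence_of_retraction (congr_app (h.powCotensor.toHolim_ofHolim hn hm) X)
    (h.simplicialHomotopic_ofHolim_toHolim hn hm X)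

end ModelCategory

lemma isEquivalence_of_isIso {G G' : Grpd.{v, v}} (F : G ⟶ G') [IsIso F] :
    Functor.IsEquivalence F :=
  Functor.IsEquivalence.mk' (inv F) (eqToIso (IsIso.hom_inv_id F).symm)
    (eqToIso (IsIso.inv_hom_id F))

end

end HolimGrpd

theorem mainTheorem2_general {n m : ℕ} (hn : 2 ≤ n) (hm : 1 ≤ m) :
    (∀ (C : Type u) [Category.{v} C] [HasProducts.{0} C] [HasEqualizers C]
        [SimplicialCategory C] [TensoredCotensored SSet.{v} C]
        [EnrichedOrdinaryCategory Grpd.{v, v} C] [TensoredCotensored Grpd.{v, v} C]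
        (_ : DerivesFromGrpd C),
      (∃ τ : truncTot (powFunctor SSet.{v} C) n m ⟶ holim (powFunctor SSet.{v} C),
        ∀ X : SimplexCategory ⥤ C, IsSimplicialHomotopyEquiv (τ.app X) ∧
          ∀ [ModelCategory C] [IsSimplicialModelCategory C], WeakEquivalence (τ.app X)) ∧
      ∀ m' : ℕ, 1 ≤ m' →
        ∃ e : truncTot (powFunctor SSet.{v} C) n m ≅ truncTot (powFunctor SSet.{v} C) n m',
          ∀ X : SimplexCategory ⥤ C, e.hom.app X ≫ truncTotι (powFunctor SSet.{v} C) n m' X =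
            truncTotι (powFunctor SSet.{v} C) n m X) ∧
    Nonempty (descFunctor.{v} ≅ truncTot grpdPow.{v} n m) ∧
    (∃ τ : descFunctor.{v} ⟶ holim grpdPow.{v}, ∀ X : SimplexCategory ⥤ Grpd.{v, v},
      Functor.IsEquivalence (τ.app X)) := by
  refine ⟨fun C _ _ _ _ _ _ _ h => ⟨⟨h.powCotensor.toHolim hn hm, fun X =>
      ⟨h.isSimplicialHomotopyEquiv_toHolim hn hm X, h.weakEquivalence_toHolim hn hm X⟩⟩,
    fun m' hm' => ⟨h.powCotensor.truncTotIso hn hm hn hm',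
      h.powCotensor.truncTotIso_hom_ι hn hm hm'⟩⟩,
    ⟨descIso hn hm⟩, (descIso hn hm).hom ≫ grpdPowCotensor.toHolim hn hm, fun X => ?_⟩
  have := isEquivalence_of_isIso ((descIso.{v} hn hm).hom.app X)
  have := isEquivalence_toHolim hn hm X
  exact Functor.isEquivalence_trans ((descIso.{v} hn hm).hom.app X)
    ((grpdPowCotensor.toHolim hn hm).app X)

theorem mainTheorem2 :
    -- a simplicial model category whose simplicial structure derives from a groupoid enrichment
    (∀ (C : Type u) [Category.{v} C] [ModelCategory C] [HasProducts.{0} C]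
        [SimplicialCategory C] [TensoredCotensored SSet.{v} C] [IsSimplicialModelCategory C]
        [EnrichedOrdinaryCategory Grpd.{v, v} C] [TensoredCotensored Grpd.{v, v} C]
        (_ : DerivesFromGrpd C),
      -- the equalizer is naturally equivalent to the homotopy limit
      (∃ τ : truncTot (powFunctor SSet.{v} C) 2 1 ⟶ holim (powFunctor SSet.{v} C),
        ∀ X : SimplexCategory ⥤ C, (∀ n, IsFibrant (X.obj n)) →
          WeakEquivalence (τ.app X) ∧ IsSimplicialHomotopyEquiv (τ.app X)) ∧
      -- and it is `Tot_2`
      (∃ e : truncTot (powFunctor SSet.{v} C) 2 1 ≅ truncTot (powFunctor SSet.{v} C) 2 2,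
        ∀ X : SimplexCategory ⥤ C, e.hom.app X ≫ truncTotι (powFunctor SSet.{v} C) 2 2 X =
          truncTotι (powFunctor SSet.{v} C) 2 1 X)) ∧
    -- for cosimplicial groupoids it is the descent groupoid
    Nonempty (descFunctor.{v} ≅ truncTot grpdPow.{v} 2 1) ∧
    Nonempty (descFunctor.{v} ≅ truncTot grpdPow.{v} 2 2) ∧
    (∃ τ : descFunctor.{v} ⟶ holim grpdPow.{v}, ∀ X : SimplexCategory ⥤ Grpd.{v, v},
      Functor.IsEquivalence (τ.app X)) := by
  obtain ⟨simplicial, desc_iso, desc_holim⟩ := mainTheorem2_general.{v, u} le_rfl le_rfl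
  obtain ⟨-, desc_iso', -⟩ := mainTheorem2_general.{v, u} le_rfl one_le_two
  refine ⟨fun C _ _ _ _ _ _ _ _ h => ?_, desc_iso, desc_iso', desc_holim⟩
  obtain ⟨⟨τ, hτ⟩, tot_iso⟩ := simplicial C h
  exact ⟨⟨τ, fun X _ => ⟨(hτ X).2, (hτ X).1⟩⟩, tot_iso 2 one_le_two⟩
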